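/- Let $(X,\mathcal B,m)$ be a localizable measure space, i.e. every $A\in\mathcal B$ with $m(A)=\infty$ contains some $A'\in\mathcal B$ with $0<m(A')<\infty$, and for every $\mathcal A\subseteq\mathcal B$ there is $S\in\mathcal B$ with $m(A\setminus S)=0$ for all $A\in\mathcal A$ and such that $m(S\setminus G)=0$ whenever $G\in\mathcal B$ satisfies $m(A\setminus G)=0$ for all $A\in\mathcal A$. Let $L^0(m)$ be the space of $m$-a.e. classes of real-valued measurable functions, with the topology of local convergence in measure, i.e. the topology generated by the balls of the pseudometrics $d_U(f,g)=\int_U |f-g|\wedge 1\,dm$, $U\in\mathcal B$, $m(U)<\infty$. A quadratic form on $L^0(m)$ is a map $E:L^0(m)\to[0,\infty]$ with $2E(f)+2E(g)=E(f-g)+E(f+g)$ and $E(\lambda f)=|\lambda|^2E(f)$ for all $f,g\in L^0(m)$, $\lambda\in\mathbb R$ (where $0\cdot\infty=0$). It is closed if its domain $D(E)=\{f: E(f)<\infty\}$ is complete for the vector space topology generated by the topology of local convergence in measure together with the seminorm $E^{1/2}$. A normal contraction is a map $C:\mathbb R^n\to\mathbb R$ with $C(0)=0$ and $|C(x)-C(y)|\le\sum_{i=1}^n|x_i-y_i|$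 for all $x,y\in\mathbb R^n$. For $\varepsilon>0$, an $\varepsilon$-cutoff is a monotone increasing normal contraction $C:\mathbb R\to\mathbb R$ with values in $[-\varepsilon,1+\varepsilon]$ and $C(x)=x$ for $x\in[0,1]$. The form $E$ is Markovian if for each $\varepsilon>0$ there is an $\varepsilon$-cutoff $C_\varepsilon$ with $E(C_\varepsilon\circ f)\le E(f)$ for all $f\in L^0(m)$. A closed Markovian quadratic form on $L^0(m)$ is called an energy form. Theorem. Let $E$ be a closed quadratic form on $L^0(m)$. The following assertions are equivalent. (i) $E$ is an energy form. (ii) For every normal contraction $C:\mathbb R\to\mathbb R$ and every $f\in L^0(m)$, $E(C\circ f)\le E(f)$. (iii) For every $n$, every normal contraction $C:\mathbb R^n\to\mathbb R$ and all $f_1,\dots,f_n\in L^0(m)$, $$E(C(f_1,\dots,f_n))^{1/2}\le\sum_{k=1}^nE(f_k)^{1/2}.$$ (iv) For every $n$ and all $f,f_1,\dots,f_n\in L^0(m)$, the inequalities $$|f(x)|\le\sum_{k=1}^n|f_k(x)|\ \text{ for $m$-a.e. }x\in X$$ and $$|f(x)-f(y)|\le\sum_{k=1}^n|f_k(x)-f_k(y)|\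 \text{ for $m$-a.e. }x\in X\text{ and $m$-a.e. }y\in X$$ imply $$E(f)^{1/2}\le\sum_{k=1}^nE(f_k)^{1/2}.$$ -/

import Mathlib

open MeasureTheory

open scoped ENNReal

/-- A (positive, extended-real-valued) quadratic form on a real vector space. In `ℝ≥0∞` one has
`0 * ∞ = 0`, `x * ∞ = ∞` for `x > 0` and `x + ∞ = ∞`. -/
structure PosQuadForm (V : Type*) [AddCommGroup V] [Module ℝ V] where
  toFun : V → ℝ≥0∞
  parallelogram' : ∀ u v : V, 2 * toFun u + 2 * toFun v = toFun (u - v) + toFun (u + v)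
  homogeneous' : ∀ (a : ℝ) (u : V), toFun (a • u) = ENNReal.ofReal (|a| ^ 2) * toFun u

namespace PosQuadForm

variable {V : Type*} [AddCommGroup V] [Module ℝ V]

instance : CoeFun (PosQuadForm V) (fun _ => V → ℝ≥0∞) := ⟨PosQuadForm.toFun⟩

theorem map_zero (q : PosQuadForm V) : q 0 = 0 := by
  have h := q.homogeneous' 0 0
  simpa using h

/-- The domain `D(q) = {u | q u < ∞}`, as a linear subspace. -/
def domain (q : PosQuadForm V) : Submodule ℝ V where
  carrier := {u | q u < ∞}
  zero_mem' := by
    change q 0 < ∞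
    rw [q.map_zero]
    exact ENNReal.zero_lt_top
  add_mem' := by
    intro u v hu hv
    change q u < ∞ at hu
    change q v < ∞ at hv
    change q (u + v) < ∞
    refine lt_of_le_of_lt (b := 2 * q u + 2 * q v) ?_ ?_
    · rw [q.parallelogram' u v]
      exact le_add_self
    · exact ENNReal.add_lt_top.2
        ⟨ENNReal.mul_lt_top (by norm_num) hu, ENNReal.mul_lt_top (by norm_num) hv⟩
  smul_mem' := by
    intro a u hu
    change q u < ∞ at hu
    change q (a • u) < ∞
    rw [q.homogeneous' a u]
    exact ENNReal.mul_lt_top ENNReal.ofReal_lt_top hu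

/-- The form seminorm `‖u‖_q = q(u)^{1/2}` on `D(q)`. -/
noncomputable def formSeminorm (q : PosQuadForm V) (u : q.domain) : ℝ :=
  Real.sqrt (q (u : V)).toReal

/-- The topology on `D(q)` generated by the open balls of the form seminorm. -/
abbrev seminormTopology (q : PosQuadForm V) : TopologicalSpace q.domain :=
  TopologicalSpace.generateFrom
    {B | ∃ (u : q.domain) (r : ℝ), 0 < r ∧ B = {v | q.formSeminorm (v - u) < r}}

/-- The form topology on `D(q)`: the smallest topology containing both the subspace topology and
the topology of the form seminorm (for Mathlib's order on topologies, this is the infimum). -/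
abbrev formTopology (q : PosQuadForm V) (t : TopologicalSpace V) : TopologicalSpace q.domain :=
  TopologicalSpace.induced (fun u : q.domain => (u : V)) t ⊓ q.seminormTopology

end PosQuadForm

/-- Completeness of an additive group `G` with topology `t` for the translation invariant uniform
structure whose entourages are `{(u, v) | u - v ∈ W}`, `W` a neighborhood of `0`: every Cauchy
filter (equivalently, every Cauchy net) converges. -/
def IsCompleteForTopology {G : Type*} [AddCommGroup G] (t : TopologicalSpace G) : Prop :=
  ∀ F : Filter G, F.NeBot →
    (∀ W ∈ @nhds G t 0, ∃ A ∈ F, ∀ u ∈ A, ∀ v ∈ A, u - v ∈ W) →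
    ∃ a : G, F ≤ @nhds G t a

/-- A quadratic form `q` is closed with respect to `t` if `D(q)` is complete for the form
topology. -/
def PosQuadForm.IsClosedForm {V : Type*} [AddCommGroup V] [Module ℝ V] (q : PosQuadForm V)
    (t : TopologicalSpace V) : Prop :=
  IsCompleteForTopology (q.formTopology t)

section Measure

variable {X : Type*} [MeasurableSpace X]

/-- Semi-finite measures: sets of infinite measure contain sets of positive finite measure. -/
def IsSemifiniteMeasure (m : Measure X) : Prop :=
  ∀ A : Set X, MeasurableSet A → m A = ∞ →
    ∃ A' : Set X, A' ⊆ A ∧ MeasurableSet A' ∧ 0 < m A' ∧ m A' < ∞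

/-- Localizable measures: semi-finite, and every family of measurable sets has an essential
supremum. -/
def IsLocalizableMeasure (m : Measure X) : Prop :=
  IsSemifiniteMeasure m ∧
  ∀ 𝒜 : Set (Set X), (∀ A ∈ 𝒜, MeasurableSet A) →
    ∃ S : Set X, MeasurableSet S ∧ (∀ A ∈ 𝒜, m (A \ S) = 0) ∧
      ∀ G : Set X, MeasurableSet G → (∀ A ∈ 𝒜, m (A \ G) = 0) → m (S \ G) = 0

/-- The pseudometric `d_U(f, g) = ∫_U |f - g| ∧ 1 dm` on `L⁰(m)`. -/
noncomputable def localDist (m : Measure X) (U : Set X) (f g : X →ₘ[m] ℝ) : ℝ≥0∞ :=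
  ∫⁻ x in U, ENNReal.ofReal (min |f x - g x| 1) ∂m

/-- The topology of local convergence in measure on `L⁰(m)`: the smallest topology containing all
balls of the pseudometrics `d_U`, `U` measurable of finite measure. -/
abbrev localMeasureTopology (m : Measure X) : TopologicalSpace (X →ₘ[m] ℝ) :=
  TopologicalSpace.generateFrom
    {B | ∃ (U : Set X) (f : X →ₘ[m] ℝ) (r : ℝ), MeasurableSet U ∧ m U < ∞ ∧ 0 < r ∧
      B = {g | localDist m U g f < ENNReal.ofReal r}}

end Measure

/-- Normal contractions `C : ℝⁿ → ℝ`. -/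
def IsNormalContraction {n : ℕ} (C : (Fin n → ℝ) → ℝ) : Prop :=
  C 0 = 0 ∧ ∀ x y : Fin n → ℝ, |C x - C y| ≤ ∑ i, |x i - y i|

/-- Normal contractions `C : ℝ → ℝ`. -/
def IsNormalContraction₁ (C : ℝ → ℝ) : Prop :=
  C 0 = 0 ∧ ∀ x y : ℝ, |C x - C y| ≤ |x - y|

/-- `ε`-cutoffs. -/
structure IsCutoff (ε : ℝ) (C : ℝ → ℝ) : Prop where
  normal : IsNormalContraction₁ C
  mono : Monotone C
  range_mem : ∀ x : ℝ, C x ∈ Set.Icc (-ε) (1 + ε)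
  eq_self : ∀ x ∈ Set.Icc (0 : ℝ) 1, C x = x

theorem IsNormalContraction₁.continuous {C : ℝ → ℝ} (hC : IsNormalContraction₁ C) :
    Continuous C := by
  have h : LipschitzWith 1 C := LipschitzWith.of_dist_le_mul fun x y => by
    simpa [Real.dist_eq] using hC.2 x y
  exact h.continuous

theorem IsNormalContraction.continuous {n : ℕ} {C : (Fin n → ℝ) → ℝ}
    (hC : IsNormalContraction C) : Continuous C := by
  rw [continuous_iff_continuousAt]
  intro y
  rw [ContinuousAt, tendsto_iff_dist_tendsto_zero]
  have h : Continuous fun x : Fin n → ℝ => ∑ i, |x i - y i| := by fun_prop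
  have h0 := h.tendsto y
  simp only [sub_self, abs_zero, Finset.sum_const_zero] at h0
  refine squeeze_zero (fun _ => dist_nonneg) (fun x => ?_) h0
  rw [Real.dist_eq]
  exact hC.2 x y

section EnergyForm

variable {X : Type*} [MeasurableSpace X] {m : Measure X}

/-- The class `C ∘ f` in `L⁰(m)`, for a normal contraction `C : ℝ → ℝ` and `f ∈ L⁰(m)`. -/
noncomputable def IsNormalContraction₁.comp {C : ℝ → ℝ} (hC : IsNormalContraction₁ C)
    (f : X →ₘ[m] ℝ) : X →ₘ[m] ℝ :=
  AEEqFun.comp C hC.continuous f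

/-- The class `C(f₁, …, fₙ)` in `L⁰(m)`, for a normal contraction `C : ℝⁿ → ℝ` and
`f₁, …, fₙ ∈ L⁰(m)`. -/
noncomputable def IsNormalContraction.comp {n : ℕ} {C : (Fin n → ℝ) → ℝ}
    (hC : IsNormalContraction C) (f : Fin n → (X →ₘ[m] ℝ)) : X →ₘ[m] ℝ :=
  AEEqFun.mk (fun x => C fun k => f k x)
    (hC.continuous.comp_aestronglyMeasurable
      (aemeasurable_pi_lambda _ fun k => (f k).aemeasurable).aestronglyMeasurable)

/-- Markovian quadratic forms on `L⁰(m)`. -/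
def IsMarkovian (E : PosQuadForm (X →ₘ[m] ℝ)) : Prop :=
  ∀ ε : ℝ, 0 < ε → ∃ (C : ℝ → ℝ) (hC : IsCutoff ε C),
    ∀ f : X →ₘ[m] ℝ, E (hC.normal.comp f) ≤ E f

/-- Energy forms: closed Markovian quadratic forms on `L⁰(m)`, where `m` is localizable. -/
structure IsEnergyForm (E : PosQuadForm (X →ₘ[m] ℝ)) : Prop where
  localizable : IsLocalizableMeasure m
  closed : E.IsClosedForm (localMeasureTopology m)
  markovian : IsMarkovian E

end EnergyForm

/-! The substance is (i) ⇒ (iv); (iv) ⇒ (iii) ⇒ (ii) is specialization, and (ii) ⇒ (i) uses the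
clamp onto `[0, 1]`.

`E` is approximated from below by `E_{U,α}(f) = inf_h E(h) + α ∫_U (f - h)² dm`, with `m(U) < ∞`.
These are again Markovian quadratic forms, and they are bounded by the `L²`-form of the finite
measure `ν = α m|_U`. For such a form `Q` and disjoint sets `A_i`, the cutoffs force the matrix
`Q(1_{A_i}, 1_{A_j})` to have nonpositive off-diagonal entries and nonnegative row sums. Hence on
simple functions `Q` is a nonnegative combination of the squares `(a_i - a_j)²` and `a_i²`, and (iv)
is Minkowski's inequality (`sqrt_matrix_form_le`). Uniform approximation by simple functions extends
(iv) to bounded functions, with errors controlled by `Q ≤ ‖·‖²_{L²(ν)}`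
(`IsMarkovian.rpow_half_le_sum_of_bounded`).

Closedness is used once, to show that `E` is the supremum of the `E_{U,α}`
(`PosQuadForm.IsClosedForm.le_of_infConv_le`). Approximate minimizers `h` are `E`-Cauchy by the
parallelogram law and converge to `f` locally in measure, so they converge to `f` in the form
topology. -/

/-! ### Polarization and the form seminorm. -/

/-- A nonnegative homogeneous function satisfying the parallelogram law is a quadratic form. -/
noncomputable def QuadraticForm.ofParallelogram {V : Type*} [AddCommGroup V] [Module ℝ V]
    (q : V → ℝ) (hpar : ∀ u v, 2 * q u + 2 * q v = q (u - v) + q (u + v))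
    (hsmul : ∀ (a : ℝ) u, q (a • u) = (a * a) • q u) (hnonneg : ∀ u, 0 ≤ q u) :
    QuadraticForm ℝ V :=
  have hadd : ∀ u u' v, QuadraticMap.polar q (u + u') v =
      QuadraticMap.polar q u v + QuadraticMap.polar q u' v := by
    intro u w v
    simp only [QuadraticMap.polar]
    -- Additivity amounts to `q(u+v+w) + q(u) + q(v) + q(w) = q(u+v) + q(u+w) + q(v+w)`, a linear
    -- combination of these parallelogram identities.
    have h1 := hpar (u + v) w
    have h2 := hpar (u + w) v
    have h3 := hpar (v + w) u
    have h4 := hpar u (v - w)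
    have h5 := hpar v (w - u)
    have h6 := hpar w (u - v)
    have h7 := hpar u v
    have h8 := hpar u w
    have h9 := hpar v w
    have hneg : ∀ u v, q (u - v) = q (v - u) := fun u v => by
      have := hsmul (-1) (u - v)
      simpa using this.symm
    have e1 : u + w + v = u + v + w := by abel
    have e2 : v + w + u = u + v + w := by abel
    have e4 : u - (v - w) = u + w - v := by abel
    have e4' : u + (v - w) = u + v - w := by abel
    have e5 : v - (w - u) = u + v - w := by abel
    have e5' : v + (w - u) = v + w - u := by abel
    have e6 : w - (u - v) = v + w - u := by abel
    have e6' : w + (u - v) = u + w - v := by abel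
    have e7 : q (w - u) = q (u - w) := hneg _ _
    rw [e1] at h2
    rw [e2] at h3
    rw [e4, e4'] at h4
    rw [e5, e5', e7] at h5
    rw [e6, e6'] at h6
    rw [e1]
    have e8 : q (v + w) = q (w + v) := by rw [add_comm]
    linarith
  have hsmul_polar : ∀ (a : ℝ) u v, QuadraticMap.polar q (a • u) v =
      a • QuadraticMap.polar q u v := by
    intro a u v
    -- `t ↦ polar (t u) v` is additive. Nonnegativity of `q` bounds it below on `(-1, 1)`, oddness
    -- bounds it above, and a locally bounded additive map is continuous, hence linear.
    let A : ℝ →+ ℝ := AddMonoidHom.mk' (fun t => QuadraticMap.polar q (t • u) v) fun s t => by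
      rw [add_smul, hadd]
    have hlow : ∀ t : ℝ, |t| < 1 → -(q u + q v) ≤ A t := by
      intro t ht
      have h0 := hnonneg (t • u + v)
      have h1 := hsmul t u
      have h2 : t * t ≤ 1 := by nlinarith [abs_nonneg t, abs_mul_abs_self t]
      have h3 := mul_le_mul_of_nonneg_right h2 (hnonneg u)
      simp only [A, AddMonoidHom.mk'_apply, QuadraticMap.polar]
      rw [smul_eq_mul] at h1
      linarith
    have hA : Continuous A := by
      refine A.continuous_of_isBounded_nhds_zero (Metric.ball_mem_nhds 0 one_pos) ?_
      rw [isBounded_iff_forall_norm_le]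
      refine ⟨q u + q v, ?_⟩
      rintro _ ⟨t, ht, rfl⟩
      rw [mem_ball_zero_iff, Real.norm_eq_abs] at ht
      rw [Real.norm_eq_abs, abs_le]
      refine ⟨hlow t ht, ?_⟩
      have := hlow (-t) (by rwa [abs_neg])
      rw [map_neg] at this
      linarith
    have := map_real_smul A hA a 1
    simpa [A] using this
  QuadraticMap.ofPolar q hsmul hadd hsmul_polar

namespace PosQuadForm

variable {V : Type*} [AddCommGroup V] [Module ℝ V] (q : PosQuadForm V)

theorem ne_top (u : q.domain) : q (u : V) ≠ ∞ := ne_of_lt u.2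

theorem parallelogram_toReal (u v : q.domain) :
    2 * (q (u : V)).toReal + 2 * (q (v : V)).toReal =
      (q ((u - v : q.domain) : V)).toReal + (q ((u + v : q.domain) : V)).toReal := by
  have h := congrArg ENNReal.toReal (q.parallelogram' (u : V) (v : V))
  have h1 := q.ne_top (u - v)
  have h2 := q.ne_top (u + v)
  rw [Submodule.coe_sub] at h1
  rw [Submodule.coe_add] at h2
  rw [ENNReal.toReal_add (ENNReal.mul_ne_top (by simp) (q.ne_top u))
    (ENNReal.mul_ne_top (by simp) (q.ne_top v)), ENNReal.toReal_add h1 h2] at h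
  simpa using h

theorem smul_toReal (a : ℝ) (u : V) : (q (a • u)).toReal = a ^ 2 * (q u).toReal := by
  rw [q.homogeneous', ENNReal.toReal_mul, ENNReal.toReal_ofReal (by positivity), sq_abs]

/-- The real quadratic form on the domain. -/
noncomputable def toQuadraticForm : QuadraticForm ℝ q.domain :=
  QuadraticForm.ofParallelogram (fun u => (q (u : V)).toReal) q.parallelogram_toReal
    (fun a u => by
      change (q (a • (u : V))).toReal = _
      rw [q.smul_toReal, sq, smul_eq_mul])
    fun _ => ENNReal.toReal_nonneg

/-- The symmetric bilinear form on the domain. -/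
noncomputable def bilin : LinearMap.BilinForm ℝ q.domain :=
  QuadraticMap.associated q.toQuadraticForm

theorem bilin_self (u : q.domain) : q.bilin u u = (q (u : V)).toReal :=
  QuadraticMap.associated_eq_self_apply ℝ q.toQuadraticForm u

theorem bilin_comm (u v : q.domain) : q.bilin u v = q.bilin v u :=
  QuadraticMap.associated_isSymm ℝ q.toQuadraticForm u v

theorem bilin_self_nonneg (u : q.domain) : 0 ≤ q.bilin u u := by
  rw [bilin_self]; exact ENNReal.toReal_nonneg

theorem bilin_sq_le (u v : q.domain) : q.bilin u v ^ 2 ≤ q.bilin u u * q.bilin v v :=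
  LinearMap.BilinForm.apply_sq_le_of_symm _ q.bilin_self_nonneg ⟨q.bilin_comm⟩ u v

theorem formSeminorm_nonneg (u : q.domain) : 0 ≤ q.formSeminorm u := Real.sqrt_nonneg _

theorem formSeminorm_sq (u : q.domain) : q.formSeminorm u ^ 2 = (q (u : V)).toReal :=
  Real.sq_sqrt ENNReal.toReal_nonneg

theorem formSeminorm_add_le (u v : q.domain) :
    q.formSeminorm (u + v) ≤ q.formSeminorm u + q.formSeminorm v := by
  have hu := q.formSeminorm_nonneg u
  have hv := q.formSeminorm_nonneg v
  refine abs_le_of_sq_le_sq' ?_ (add_nonneg hu hv) |>.2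
  have h : q.bilin u v ≤ q.formSeminorm u * q.formSeminorm v := by
    refine abs_le_of_sq_le_sq' ?_ (mul_nonneg hu hv) |>.2
    rw [mul_pow, formSeminorm_sq, formSeminorm_sq, ← bilin_self, ← bilin_self]
    exact q.bilin_sq_le u v
  have e : (q ((u + v : q.domain) : V)).toReal =
      (q (u : V)).toReal + 2 * q.bilin u v + (q (v : V)).toReal := by
    simp only [← bilin_self, map_add, LinearMap.add_apply, q.bilin_comm v u]
    ring
  rw [formSeminorm_sq, e, ← formSeminorm_sq, ← formSeminorm_sq]
  nlinarith

theorem rpow_half_eq (u : q.domain) :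
    q (u : V) ^ (1 / 2 : ℝ) = ENNReal.ofReal (q.formSeminorm u) := by
  rw [formSeminorm, Real.sqrt_eq_rpow, ← ENNReal.ofReal_rpow_of_nonneg ENNReal.toReal_nonneg
    (by norm_num), ENNReal.ofReal_toReal (q.ne_top u)]

theorem rpow_half_add_le (u v : V) :
    q (u + v) ^ (1 / 2 : ℝ) ≤ q u ^ (1 / 2 : ℝ) + q v ^ (1 / 2 : ℝ) := by
  rcases eq_or_ne (q u) ∞ with hu | hu
  · simp [hu]
  rcases eq_or_ne (q v) ∞ with hv | hv
  · simp [hv]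
  let u' : q.domain := ⟨u, hu.lt_top⟩
  let v' : q.domain := ⟨v, hv.lt_top⟩
  have h := q.rpow_half_eq (u' + v')
  rw [Submodule.coe_add] at h
  rw [h, q.rpow_half_eq u', q.rpow_half_eq v',
    ← ENNReal.ofReal_add (q.formSeminorm_nonneg _) (q.formSeminorm_nonneg _)]
  exact ENNReal.ofReal_le_ofReal (q.formSeminorm_add_le u' v')

theorem map_neg (u : V) : q (-u) = q u := by
  have := q.homogeneous' (-1) u
  simpa using this

/-! ### Infimal convolution. -/

/-- The infimal convolution of two quadratic forms. -/
noncomputable def infConv (p q : PosQuadForm V) : PosQuadForm V where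
  toFun f := ⨅ h, p h + q (f - h)
  parallelogram' := by
    set P : V → ℝ≥0∞ := fun f => ⨅ h, p h + q (f - h) with hP
    have hle : ∀ u v, P (u - v) + P (u + v) ≤ 2 * P u + 2 * P v := by
      intro u v
      simp only [hP]
      rw [ENNReal.mul_iInf_of_ne (by simp) (by simp), ENNReal.mul_iInf_of_ne (by simp) (by simp)]
      refine ENNReal.le_iInf_add_iInf fun g h => ?_
      · refine (add_le_add (iInf_le _ (g - h)) (iInf_le _ (g + h))).trans_eq ?_
        have h1 := p.parallelogram' g h
        have h2 := q.parallelogram' (u - g) (v - h)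
        have e1 : u - g - (v - h) = u - v - (g - h) := by abel
        have e2 : u - g + (v - h) = u + v - (g + h) := by abel
        rw [e1, e2] at h2
        calc _ = (p (g - h) + p (g + h)) + (q (u - v - (g - h)) + q (u + v - (g + h))) := by ring
          _ = _ := by rw [← h1, ← h2]; ring
    have hsmul : ∀ u, P ((2 : ℝ) • u) = 4 * P u := by
      intro u
      have key : ∀ h, p ((2 : ℝ) • h) + q ((2 : ℝ) • u - (2 : ℝ) • h) =
          4 * (p h + q (u - h)) := by
        intro h
        rw [← smul_sub, p.homogeneous', q.homogeneous', mul_add]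
        norm_num
      simp only [hP]
      rw [ENNReal.mul_iInf_of_ne (by simp) (by simp), ← (Equiv.smulRight (β := V)
        (two_ne_zero : (2 : ℝ) ≠ 0)).surjective.iInf_comp]
      exact iInf_congr key
    intro u v
    refine le_antisymm ?_ (hle u v)
    -- The reverse inequality is the one already proved, applied to `u + v` and `u - v` and divided
    -- by two.
    have h := hle (u + v) (u - v)
    have e1 : u + v - (u - v) = (2 : ℝ) • v := by rw [two_smul]; abel
    have e2 : u + v + (u - v) = (2 : ℝ) • u := by rw [two_smul]; abel
    rw [e1, e2, hsmul, hsmul] at h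
    have h' : 2 * (2 * P u + 2 * P v) ≤ 2 * (P (u - v) + P (u + v)) := by
      calc _ = 4 * P v + 4 * P u := by ring
        _ ≤ _ := h
        _ = _ := by ring
    exact (ENNReal.mul_le_mul_iff_right (by simp) (by simp)).1 h'
  homogeneous' := by
    intro a u
    rcases eq_or_ne a 0 with rfl | ha
    · simp only [zero_smul, abs_zero, ne_eq, OfNat.ofNat_ne_zero, not_false_eq_true, zero_pow,
        ENNReal.ofReal_zero, zero_mul]
      refine le_antisymm (iInf_le_of_le 0 ?_) zero_le
      simp [p.map_zero, q.map_zero]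
    · rw [ENNReal.mul_iInf_of_ne (by simpa using ha) (by simp), ← (Equiv.smulRight (β := V)
        ha).surjective.iInf_comp]
      refine iInf_congr fun h => ?_
      change p (a • h) + q (a • u - a • h) = _
      rw [← smul_sub, p.homogeneous', q.homogeneous', mul_add]

theorem infConv_apply (p q : PosQuadForm V) (f : V) :
    p.infConv q f = ⨅ h, p h + q (f - h) := rfl

theorem infConv_le_left (p q : PosQuadForm V) (f : V) : p.infConv q f ≤ p f :=
  (iInf_le _ f).trans_eq (by rw [sub_self, q.map_zero, add_zero])

theorem infConv_le_right (p q : PosQuadForm V) (f : V) : p.infConv q f ≤ q f :=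
  (iInf_le _ 0).trans_eq (by rw [sub_zero, p.map_zero, zero_add])

end PosQuadForm

/-! ### `L²`-forms and the Markov property of infimal convolutions. -/

section
variable {X : Type*} [MeasurableSpace X] {m : Measure X}

/-- The quadratic form `f ↦ ∫ f² dν` on `L⁰(m)`, for `ν ≪ m`. -/
noncomputable def lintegralSqForm {ν : Measure X} (hν : ν ≪ m) : PosQuadForm (X →ₘ[m] ℝ) where
  toFun f := ∫⁻ x, ENNReal.ofReal (f x ^ 2) ∂ν
  parallelogram' f g := by
    have hmeas : ∀ f : X →ₘ[m] ℝ, Measurable fun x => ENNReal.ofReal (f x ^ 2) := fun f =>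
      (f.measurable.pow_const 2).ennreal_ofReal
    rw [← lintegral_const_mul _ (hmeas f), ← lintegral_const_mul _ (hmeas g),
      ← lintegral_add_left ((hmeas f).const_mul 2), ← lintegral_add_left (hmeas _)]
    refine lintegral_congr_ae ?_
    filter_upwards [hν.ae_le (AEEqFun.coeFn_sub f g), hν.ae_le (AEEqFun.coeFn_add f g)]
      with x hs ha
    rw [hs, ha, ← ENNReal.ofReal_add (sq_nonneg _) (sq_nonneg _), ← ENNReal.ofReal_ofNat,
      ← ENNReal.ofReal_mul (by norm_num), ← ENNReal.ofReal_mul (by norm_num),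
      ← ENNReal.ofReal_add (by positivity) (by positivity)]
    congr 1
    simp only [Pi.sub_apply, Pi.add_apply]
    ring
  homogeneous' a f := by
    rw [← lintegral_const_mul _ (f.measurable.pow_const 2).ennreal_ofReal]
    refine lintegral_congr_ae ?_
    filter_upwards [hν.ae_le (AEEqFun.coeFn_smul a f)] with x hx
    rw [hx, ← ENNReal.ofReal_mul (by positivity), sq_abs, Pi.smul_apply, smul_eq_mul, mul_pow]

theorem lintegralSqForm_apply {ν : Measure X} (hν : ν ≪ m) (f : X →ₘ[m] ℝ) :
    lintegralSqForm hν f = ∫⁻ x, ENNReal.ofReal (f x ^ 2) ∂ν := rfl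

theorem lintegralSqForm_le_of_ae_le {ν : Measure X} (hν : ν ≪ m) {f : X →ₘ[m] ℝ} {c : ℝ}
    (hf : ∀ᵐ x ∂ν, |f x| ≤ c) : lintegralSqForm hν f ≤ ENNReal.ofReal (c ^ 2) * ν Set.univ := by
  rw [lintegralSqForm_apply, ← lintegral_const]
  refine lintegral_mono_ae ?_
  filter_upwards [hf] with x hx
  exact ENNReal.ofReal_le_ofReal (sq_le_sq' (abs_le.1 hx).1 (abs_le.1 hx).2)

/-- Normal contractions operate on `f ↦ ∫ f² dν`, also on differences. -/
theorem lintegralSqForm_comp_sub_comp_le {ν : Measure X} (hν : ν ≪ m) {C : ℝ → ℝ}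
    (hC : IsNormalContraction₁ C) (f g : X →ₘ[m] ℝ) :
    lintegralSqForm hν (hC.comp f - hC.comp g) ≤ lintegralSqForm hν (f - g) := by
  refine lintegral_mono_ae ?_
  filter_upwards [hν.ae_le (AEEqFun.coeFn_sub f g),
    hν.ae_le (AEEqFun.coeFn_sub (hC.comp f) (hC.comp g)),
    hν.ae_le (AEEqFun.coeFn_comp C hC.continuous f),
    hν.ae_le (AEEqFun.coeFn_comp C hC.continuous g)] with x h1 h2 h3 h4
  rw [h1, h2]
  refine ENNReal.ofReal_le_ofReal (sq_le_sq.2 ?_)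
  simp only [Pi.sub_apply, IsNormalContraction₁.comp]
  rw [h3, h4]
  exact hC.2 _ _

/-- The cutoff of `E` also serves here: if `g` competes for `f`, then `C ∘ g` competes for `C ∘ f`
at no greater cost. -/
theorem IsMarkovian.infConv_lintegralSqForm {E : PosQuadForm (X →ₘ[m] ℝ)} (hE : IsMarkovian E)
    {ν : Measure X} (hν : ν ≪ m) : IsMarkovian (E.infConv (lintegralSqForm hν)) := by
  intro ε hε
  obtain ⟨C, hC, h⟩ := hE ε hε
  refine ⟨C, hC, fun f => le_iInf fun g => iInf_le_of_le (hC.normal.comp g) ?_⟩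
  exact add_le_add (h g) (lintegralSqForm_comp_sub_comp_le hν hC.normal f g)

/-- The class of the indicator function of a measurable set. -/
noncomputable def indicatorClass (m : Measure X) {A : Set X} (hA : MeasurableSet A) :
    X →ₘ[m] ℝ :=
  AEEqFun.mk (A.indicator fun _ => 1) (stronglyMeasurable_const.indicator hA).aestronglyMeasurable

theorem coeFn_indicatorClass {A : Set X} (hA : MeasurableSet A) :
    indicatorClass m hA =ᵐ[m] A.indicator fun _ => 1 := AEEqFun.coeFn_mk _ _

theorem lintegralSqForm_indicatorClass {ν : Measure X} (hν : ν ≪ m) {A : Set X}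
    (hA : MeasurableSet A) : lintegralSqForm hν (indicatorClass m hA) = ν A := by
  rw [lintegralSqForm_apply, ← lintegral_indicator_one hA]
  refine lintegral_congr_ae ?_
  filter_upwards [hν.ae_le (coeFn_indicatorClass hA)] with x hx
  rw [hx]
  by_cases h : x ∈ A <;> simp [h]

end

/-! ### Signs of the bilinear form on indicators. -/

namespace PosQuadForm

variable {V : Type*} [AddCommGroup V] [Module ℝ V] (q : PosQuadForm V)

/-- If the bilinear term were negative, some moderate `t` would give a strictly smaller value than
all `s` near zero. -/
theorem bilin_nonneg_of_small_smul {u v : q.domain}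
    (h : ∀ t : ℝ, 0 < t → ∀ ε : ℝ, 0 < ε → ∃ s ∈ Set.Icc 0 ε,
      q (u + s • v : V) ≤ q (u + t • v : V)) : 0 ≤ q.bilin u v := by
  by_contra! hb
  set b := q.bilin u v with hbd
  have hexp : ∀ t : ℝ, (q (u + t • v : V)).toReal =
      q.bilin u u + 2 * t * b + t ^ 2 * q.bilin v v := by
    intro t
    have := q.bilin_self (u + t • v)
    rw [Submodule.coe_add, Submodule.coe_smul] at this
    rw [← this]
    simp only [map_add, LinearMap.add_apply, map_smul, LinearMap.smul_apply, smul_eq_mul,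
      q.bilin_comm v u]
    ring
  have hv := q.bilin_self_nonneg v
  -- The `+ 1` covers `q v = 0`. Since `t q(v) < -b`, the increment at `t` is below `t b`, while for
  -- `0 ≤ s ≤ t / 4` it is at least `t b / 2`.
  have ht : 0 < -b / (q.bilin v v + 1) := by apply div_pos <;> linarith
  set t := -b / (q.bilin v v + 1) with htd
  obtain ⟨s, ⟨hs0, hs⟩, hle⟩ := h t ht (t / 4) (by positivity)
  have hfin : q (u + t • v : V) ≠ ∞ := q.ne_top (u + t • v)
  have h1 := ENNReal.toReal_mono hfin hle
  rw [hexp, hexp] at h1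
  have h2 : t * (q.bilin v v + 1) = -b := by rw [htd]; field_simp
  have h3 : 0 ≤ s ^ 2 * q.bilin v v := by positivity
  nlinarith

end PosQuadForm

section
variable {X : Type*} [MeasurableSpace X] {m : Measure X}

/-- An `ε`-cutoff turns `1_A + t 1_B` into `1_A + s 1_B` with `s = C(1 + t) - 1 ∈ [0, ε]`. -/
theorem IsMarkovian.bilin_indicator_nonneg_of_subset {E : PosQuadForm (X →ₘ[m] ℝ)}
    (hE : IsMarkovian E) {u v : E.domain} {A B : Set X} (hA : MeasurableSet A)
    (hB : MeasurableSet B) (hu : (u : X →ₘ[m] ℝ) = indicatorClass m hA)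
    (hv : (v : X →ₘ[m] ℝ) = indicatorClass m hB) (hBA : B ⊆ A) : 0 ≤ E.bilin u v := by
  refine E.bilin_nonneg_of_small_smul fun t ht ε hε => ?_
  obtain ⟨C, hC, h⟩ := hE ε hε
  have h1 : C 1 = 1 := hC.eq_self 1 (by simp)
  refine ⟨C (1 + t) - 1, ⟨?_, ?_⟩, ?_⟩
  · linarith [hC.mono (show 1 ≤ 1 + t by linarith)]
  · linarith [(hC.range_mem (1 + t)).2]
  · convert h _ using 2
    refine AEEqFun.ext ?_
    rw [hu, hv]
    filter_upwards [AEEqFun.coeFn_comp C hC.normal.continuous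
      (indicatorClass m hA + t • indicatorClass m hB), coeFn_indicatorClass (m := m) hA,
      coeFn_indicatorClass (m := m) hB,
      AEEqFun.coeFn_add (indicatorClass m hA) (t • indicatorClass m hB),
      AEEqFun.coeFn_add (indicatorClass m hA) ((C (1 + t) - 1) • indicatorClass m hB),
      AEEqFun.coeFn_smul t (indicatorClass m hB),
      AEEqFun.coeFn_smul (C (1 + t) - 1) (indicatorClass m hB)] with x e1 e2 e3 e4 e5 e6 e7
    rw [IsNormalContraction₁.comp, e1, Function.comp_apply, e4, e5, Pi.add_apply, Pi.add_apply, e6,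
      e7, Pi.smul_apply, Pi.smul_apply, e2, e3]
    by_cases hxB : x ∈ B
    · simp [hxB, hBA hxB]
    · by_cases hxA : x ∈ A <;> simp [hxA, hxB, h1, hC.normal.1]

/-- An `ε`-cutoff turns `1_A - t 1_B` into `1_A - s 1_B` with `s = -C(-t) ∈ [0, ε]`. -/
theorem IsMarkovian.bilin_indicator_nonpos_of_disjoint {E : PosQuadForm (X →ₘ[m] ℝ)}
    (hE : IsMarkovian E) {u v : E.domain} {A B : Set X} (hA : MeasurableSet A)
    (hB : MeasurableSet B) (hu : (u : X →ₘ[m] ℝ) = indicatorClass m hA)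
    (hv : (v : X →ₘ[m] ℝ) = indicatorClass m hB) (hAB : Disjoint A B) : E.bilin u v ≤ 0 := by
  suffices 0 ≤ E.bilin u (-v) by rwa [_root_.map_neg, Left.nonneg_neg_iff] at this
  refine E.bilin_nonneg_of_small_smul fun t ht ε hε => ?_
  obtain ⟨C, hC, h⟩ := hE ε hε
  have h1 : C 1 = 1 := hC.eq_self 1 (by simp)
  have h0 : C 0 = 0 := hC.normal.1
  refine ⟨-C (-t), ⟨?_, ?_⟩, ?_⟩
  · linarith [hC.mono (show -t ≤ 0 by linarith)]
  · linarith [(hC.range_mem (-t)).1]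
  · convert h _ using 2
    refine AEEqFun.ext ?_
    rw [Submodule.coe_neg, smul_neg, smul_neg, ← neg_smul, ← neg_smul, neg_neg, hu, hv]
    filter_upwards [AEEqFun.coeFn_comp C hC.normal.continuous
      (indicatorClass m hA + (-t) • indicatorClass m hB), coeFn_indicatorClass (m := m) hA,
      coeFn_indicatorClass (m := m) hB,
      AEEqFun.coeFn_add (indicatorClass m hA) ((-t) • indicatorClass m hB),
      AEEqFun.coeFn_add (indicatorClass m hA) (C (-t) • indicatorClass m hB),
      AEEqFun.coeFn_smul (-t) (indicatorClass m hB),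
      AEEqFun.coeFn_smul (C (-t)) (indicatorClass m hB)] with x e1 e2 e3 e4 e5 e6 e7
    rw [IsNormalContraction₁.comp, e1, Function.comp_apply, e4, e5, Pi.add_apply, Pi.add_apply, e6,
      e7, Pi.smul_apply, Pi.smul_apply, e2, e3]
    by_cases hxB : x ∈ B
    · have hxA : x ∉ A := fun hxA => Set.disjoint_left.1 hAB hxA hxB
      simp [hxB, hxA]
    · by_cases hxA : x ∈ A <;> simp [hxA, hxB, h1, h0]

end

/-! ### The finite-dimensional inequality. -/

/-- Minkowski's inequality for a weighted `ℓ²`-seminorm, with an additive error. -/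
theorem sqrt_weighted_sum_sq_le {P κ : Type*} [Fintype P] [Fintype κ] {W : P → ℝ}
    (hW : ∀ p, 0 ≤ W p) {x : P → ℝ} {y : κ → P → ℝ} {d : ℝ} (hd : 0 ≤ d)
    (h : ∀ p, |x p| ≤ ∑ k, |y k p| + d) :
    √(∑ p, W p * x p ^ 2) ≤ ∑ k, √(∑ p, W p * y k p ^ 2) + d * √(∑ p, W p) := by
  let v : (P → ℝ) → EuclideanSpace ℝ P := fun z => WithLp.toLp 2 fun p => √(W p) * |z p|
  have hv : ∀ z, ‖v z‖ = √(∑ p, W p * z p ^ 2) := fun z => by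
    rw [EuclideanSpace.norm_eq]
    congr 1
    refine Finset.sum_congr rfl fun p _ => ?_
    rw [Real.norm_eq_abs, sq_abs, mul_pow, Real.sq_sqrt (hW p), sq_abs]
  have hd' : d * √(∑ p, W p) = ‖v fun _ => d‖ := by
    rw [hv, ← Finset.sum_mul, Real.sqrt_mul (Finset.sum_nonneg fun p _ => hW p),
      Real.sqrt_sq hd, mul_comm]
  simp_rw [hd', ← hv]
  calc ‖v x‖ ≤ ‖∑ k, v (y k) + v fun _ => d‖ := by
        rw [EuclideanSpace.norm_eq, EuclideanSpace.norm_eq]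
        refine Real.sqrt_le_sqrt (Finset.sum_le_sum fun p _ => ?_)
        refine pow_le_pow_left₀ (norm_nonneg _) ?_ 2
        have e : (∑ k, v (y k) + v fun _ => d) p = √(W p) * (∑ k, |y k p| + d) := by
          simp [v, Finset.mul_sum, mul_add, abs_of_nonneg hd]
        rw [e, Real.norm_eq_abs, Real.norm_eq_abs, abs_mul, abs_mul, abs_abs]
        exact mul_le_mul_of_nonneg_left ((h p).trans (le_abs_self _)) (abs_nonneg _)
    _ ≤ _ := (norm_add_le _ _).trans (add_le_add_left (norm_sum_le _ _) _)

/-- The contraction property of a symmetric matrix with nonpositive off-diagonal entries and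
nonnegative row sums. -/
theorem sqrt_matrix_form_le {ι κ : Type*} [Fintype ι] [Fintype κ] {b : ι → ι → ℝ}
    (hsymm : ∀ i j, b i j = b j i) (hoff : ∀ i j, i ≠ j → b i j ≤ 0)
    (hrow : ∀ i, 0 ≤ ∑ j, b i j) {a : ι → ℝ} {c : κ → ι → ℝ} {d : ℝ} (hd : 0 ≤ d)
    (h1 : ∀ i, |a i| ≤ ∑ k, |c k i| + d)
    (h2 : ∀ i j, |a i - a j| ≤ ∑ k, |c k i - c k j| + d) :
    √(∑ i, ∑ j, a i * a j * b i j) ≤ ∑ k, √(∑ i, ∑ j, c k i * c k j * b i j) +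
      d * √((∑ i, b i i + ∑ i, ∑ j, b i j) / 2) := by
  classical
  -- The decomposition is `∑ b_ij a_i a_j = ½ ∑_{i≠j} (-b_ij)(a_i - a_j)² + ∑_i (∑_j b_ij) a_i²`;
  -- the factor ½ appears because ordered pairs are summed.
  let W : (ι × ι) ⊕ ι → ℝ :=
    Sum.elim (fun p => if p.1 = p.2 then 0 else -b p.1 p.2 / 2) fun i => ∑ j, b i j
  let L : (ι → ℝ) → (ι × ι) ⊕ ι → ℝ := fun a => Sum.elim (fun p => a p.1 - a p.2) a
  have hW : ∀ p, 0 ≤ W p := by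
    rintro (⟨i, j⟩ | i)
    · simp only [W, Sum.elim_inl]
      split_ifs with hij
      · exact le_rfl
      · linarith [hoff i j hij]
    · exact hrow i
  have hsum : ∀ a : ι → ℝ, ∑ i, ∑ j, a i * a j * b i j = ∑ p, W p * L a p ^ 2 := by
    intro a
    have e1 : ∀ i j, (if i = j then 0 else -b i j / 2) * (a i - a j) ^ 2 =
        a i * a j * b i j - a i ^ 2 * b i j / 2 - a j ^ 2 * b j i / 2 := by
      intro i j
      split_ifs with hij
      · subst hij; ring
      · rw [hsymm j i]; ring
    simp only [Fintype.sum_sum_type, Fintype.sum_prod_type, W, L, Sum.elim_inl, Sum.elim_inr, e1,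
      Finset.sum_sub_distrib]
    rw [Finset.sum_comm (f := fun i j => a j ^ 2 * b j i / 2)]
    simp only [← Finset.sum_div, ← Finset.mul_sum, mul_comm _ (a _ ^ 2)]
    ring
  have hWsum : ∑ p, W p = (∑ i, b i i + ∑ i, ∑ j, b i j) / 2 := by
    have e1 : ∀ i j, (if i = j then 0 else -b i j / 2) =
        (if i = j then b i j / 2 else 0) - b i j / 2 := by
      intro i j
      split_ifs <;> ring
    simp only [Fintype.sum_sum_type, Fintype.sum_prod_type, W, Sum.elim_inl, Sum.elim_inr, e1,
      Finset.sum_sub_distrib, Finset.sum_ite_eq, Finset.mem_univ, if_true, ← Finset.sum_div]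
    ring
  simp_rw [hsum, ← hWsum]
  refine sqrt_weighted_sum_sq_le hW hd ?_
  rintro (⟨i, j⟩ | i)
  · exact h2 i j
  · exact h1 i

/-! ### The inequality (iv) for Markovian forms dominated by a finite measure. -/

section
variable {X : Type*} [MeasurableSpace X] {m : Measure X}

theorem coeFn_sum_smul_indicatorClass {ι : Type*} [Fintype ι] {A : ι → Set X}
    (hA : ∀ i, MeasurableSet (A i)) (hdisj : Pairwise (Function.onFun Disjoint A)) (a : ι → ℝ) :
    ∀ᵐ x ∂m, (∀ i, x ∈ A i → (∑ i, a i • indicatorClass m (hA i) : X →ₘ[m] ℝ) x = a i) ∧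
      ((∀ i, x ∉ A i) → (∑ i, a i • indicatorClass m (hA i) : X →ₘ[m] ℝ) x = 0) := by
  have h1 : ∀ᵐ x ∂m, ∀ i, (a i • indicatorClass m (hA i) : X →ₘ[m] ℝ) x =
      a i * (A i).indicator (fun _ => 1) x := by
    rw [ae_all_iff]
    intro i
    filter_upwards [AEEqFun.coeFn_smul (a i) (indicatorClass m (hA i)),
      coeFn_indicatorClass (m := m) (hA i)] with x e1 e2
    rw [e1, Pi.smul_apply, e2, smul_eq_mul]
  filter_upwards [h1, AEEqFun.coeFn_fun_finsetSum Finset.univ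
    fun i => a i • indicatorClass m (hA i)] with x e1 e2
  rw [e2]
  simp only [e1]
  refine ⟨fun i hi => ?_, fun h => Finset.sum_eq_zero fun i _ => by simp [h i]⟩
  rw [Finset.sum_eq_single i]
  · simp [hi]
  · intro j _ hji
    have : x ∉ A j := fun hj => Set.disjoint_left.1 (hdisj hji) hj hi
    simp [this]
  · simp

theorem rpow_half_le_of_ae_le {Q : PosQuadForm (X →ₘ[m] ℝ)} {ν : Measure X} {hν : ν ≪ m}
    (hle : ∀ f, Q f ≤ lintegralSqForm hν f) {f : X →ₘ[m] ℝ} {d : ℝ} (hd : 0 ≤ d)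
    (hf : ∀ᵐ x ∂ν, |f x| ≤ d) :
    Q f ^ (1 / 2 : ℝ) ≤ ENNReal.ofReal d * ν Set.univ ^ (1 / 2 : ℝ) := by
  have h := (hle f).trans (lintegralSqForm_le_of_ae_le hν hf)
  refine (ENNReal.rpow_le_rpow h (by norm_num)).trans_eq ?_
  rw [ENNReal.mul_rpow_of_nonneg _ _ (by norm_num), ENNReal.ofReal_pow hd, ← ENNReal.rpow_natCast,
    ← ENNReal.rpow_mul]
  norm_num

theorem IsMarkovian.rpow_half_sum_indicator_le {Q : PosQuadForm (X →ₘ[m] ℝ)} (hQ : IsMarkovian Q)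
    {ν : Measure X} [IsFiniteMeasure ν] {hν : ν ≪ m} (hle : ∀ f, Q f ≤ lintegralSqForm hν f)
    {ι κ : Type*} [Fintype ι] [Fintype κ] {A : ι → Set X} (hA : ∀ i, MeasurableSet (A i))
    (hdisj : Pairwise (Function.onFun Disjoint A)) {a : ι → ℝ} {c : κ → ι → ℝ} {d : ℝ}
    (hd : 0 ≤ d) (h1 : ∀ i, |a i| ≤ ∑ k, |c k i| + d)
    (h2 : ∀ i j, |a i - a j| ≤ ∑ k, |c k i - c k j| + d) :
    Q (∑ i, a i • indicatorClass m (hA i)) ^ (1 / 2 : ℝ) ≤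
      ∑ k, Q (∑ i, c k i • indicatorClass m (hA i)) ^ (1 / 2 : ℝ) +
        ENNReal.ofReal d * ν Set.univ ^ (1 / 2 : ℝ) := by
  have hfin : ∀ {B : Set X} (hB : MeasurableSet B), Q (indicatorClass m hB) ≤ ν B := fun hB =>
    (hle _).trans_eq (lintegralSqForm_indicatorClass hν hB)
  let e : ∀ {B : Set X}, MeasurableSet B → Q.domain := fun hB =>
    ⟨indicatorClass m hB, (hfin hB).trans_lt (measure_lt_top ν _)⟩
  let b : ι → ι → ℝ := fun i j => Q.bilin (e (hA i)) (e (hA j))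
  have hsum : ∀ a : ι → ℝ, Q (∑ i, a i • indicatorClass m (hA i)) ^ (1 / 2 : ℝ) =
      ENNReal.ofReal √(∑ i, ∑ j, a i * a j * b i j) := by
    intro a
    have e1 : (∑ i, a i • indicatorClass m (hA i) : X →ₘ[m] ℝ) =
        ((∑ i, a i • e (hA i) : Q.domain) : X →ₘ[m] ℝ) := by
      simp [e]
    rw [e1, Q.rpow_half_eq, PosQuadForm.formSeminorm, ← Q.bilin_self]
    congr 2
    simp only [map_sum, LinearMap.sum_apply, map_smul, LinearMap.smul_apply, smul_eq_mul, b,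
      Finset.mul_sum]
    rw [Finset.sum_comm]
    refine Finset.sum_congr rfl fun i _ => Finset.sum_congr rfl fun j _ => by ring
  have hU : MeasurableSet (⋃ i, A i) := MeasurableSet.iUnion hA
  have hone : ((∑ i, e (hA i) : Q.domain) : X →ₘ[m] ℝ) = indicatorClass m hU := by
    refine AEEqFun.ext ?_
    have e1 : ((∑ i, e (hA i) : Q.domain) : X →ₘ[m] ℝ) =
        ∑ i, (1 : ℝ) • indicatorClass m (hA i) := by
      simp [e]
    rw [e1]
    filter_upwards [coeFn_sum_smul_indicatorClass (m := m) hA hdisj fun _ => 1,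
      coeFn_indicatorClass (m := m) hU] with x hx hx'
    rw [hx']
    by_cases h : ∃ i, x ∈ A i
    · obtain ⟨i, hi⟩ := h
      rw [hx.1 i hi, Set.indicator_of_mem (Set.mem_iUnion.2 ⟨i, hi⟩)]
    · push Not at h
      rw [hx.2 h, Set.indicator_of_notMem (by simpa using h)]
  have hrow : ∀ i, 0 ≤ ∑ j, b i j := by
    intro i
    have : ∑ j, b i j = Q.bilin (∑ j, e (hA j)) (e (hA i)) := by
      rw [Q.bilin_comm]
      simp [b]
    rw [this]
    exact hQ.bilin_indicator_nonneg_of_subset hU (hA i) hone rfl (Set.subset_iUnion A i)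
  have hoff : ∀ i j, i ≠ j → b i j ≤ 0 := fun i j hij =>
    hQ.bilin_indicator_nonpos_of_disjoint (hA i) (hA j) rfl rfl (hdisj hij)
  -- The trace and the total sum of the matrix are both at most `ν(X)`, so the error coefficient
  -- does not depend on the partition.
  have hdiag : ∑ i, b i i ≤ ν.real Set.univ := by
    calc ∑ i, b i i ≤ ∑ i, ν.real (A i) := by
          refine Finset.sum_le_sum fun i _ => ?_
          simp only [b]
          rw [Q.bilin_self]
          exact ENNReal.toReal_mono (measure_ne_top ν _) (hfin (hA i))
      _ = ν.real (⋃ i, A i) := by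
          rw [measureReal_iUnion_fintype hdisj hA]
      _ ≤ _ := measureReal_mono (Set.subset_univ _)
  have hall : ∑ i, ∑ j, b i j ≤ ν.real Set.univ := by
    have : ∑ i, ∑ j, b i j = Q.bilin (∑ j, e (hA j)) (∑ j, e (hA j)) := by
      simp only [map_sum, LinearMap.sum_apply, b]
      rw [Finset.sum_comm]
    rw [this, Q.bilin_self, hone]
    exact ENNReal.toReal_mono (measure_ne_top ν _) ((hfin hU).trans (measure_mono (Set.subset_univ _)))
  have hν' : ν Set.univ ^ (1 / 2 : ℝ) = ENNReal.ofReal √(ν.real Set.univ) := by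
    rw [Real.sqrt_eq_rpow, ← ENNReal.ofReal_rpow_of_nonneg measureReal_nonneg (by norm_num),
      ofReal_measureReal]
  rw [hsum, hν', ← ENNReal.ofReal_mul hd]
  simp only [hsum]
  rw [← ENNReal.ofReal_sum_of_nonneg fun _ _ => Real.sqrt_nonneg _,
    ← ENNReal.ofReal_add (Finset.sum_nonneg fun _ _ => Real.sqrt_nonneg _) (by positivity)]
  refine ENNReal.ofReal_le_ofReal ?_
  refine (sqrt_matrix_form_le (fun i j => Q.bilin_comm _ _) hoff hrow hd h1 h2).trans ?_
  gcongr
  linarith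

theorem IsMarkovian.rpow_half_le_sum_of_bounded {Q : PosQuadForm (X →ₘ[m] ℝ)}
    (hQ : IsMarkovian Q) {ν : Measure X} [IsFiniteMeasure ν] {hν : ν ≪ m}
    (hle : ∀ f, Q f ≤ lintegralSqForm hν f) {n : ℕ} {f : X →ₘ[m] ℝ} {g : Fin n → (X →ₘ[m] ℝ)}
    {N : ℝ} (hf : ∀ᵐ x ∂ν, |f x| ≤ N) (hg : ∀ᵐ x ∂ν, ∀ k, |g k x| ≤ N)
    (h1 : ∀ᵐ x ∂ν, |f x| ≤ ∑ k, |g k x|)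
    (h2 : ∀ᵐ x ∂ν, ∀ᵐ y ∂ν, |f x - f y| ≤ ∑ k, |g k x - g k y|) :
    Q f ^ (1 / 2 : ℝ) ≤ ∑ k, Q (g k) ^ (1 / 2 : ℝ) := by
  classical
  set c : ℝ≥0∞ := ν Set.univ ^ (1 / 2 : ℝ) with hc
  have hcfin : c ≠ ∞ := ENNReal.rpow_ne_top_of_nonneg (by norm_num) (measure_ne_top ν _)
  -- All functions are rounded down to multiples of `δ`. The factor `3n + 3` collects `n` for the `g
  -- k`, `2n + 2` for the simple-function inequality and `1` for `f`.
  have key : ∀ δ : ℝ, 0 < δ → Q f ^ (1 / 2 : ℝ) ≤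
      ∑ k, Q (g k) ^ (1 / 2 : ℝ) + ENNReal.ofReal (δ * (3 * n + 3)) * c := by
    intro δ hδ
    have hround : ∀ t : ℝ, |t - δ * ⌊t / δ⌋| ≤ δ := by
      intro t
      have h3 := Int.floor_le (t / δ)
      have h4 := Int.lt_floor_add_one (t / δ)
      rw [le_div_iff₀ hδ] at h3
      rw [div_lt_iff₀ hδ] at h4
      rw [abs_le]
      constructor <;> nlinarith
    let ℓ : X → ℤ × (Fin n → ℤ) := fun x => (⌊f x / δ⌋, fun k => ⌊g k x / δ⌋)
    have hℓ : Measurable ℓ := by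
      refine Measurable.prodMk (Int.measurable_floor.comp (f.measurable.div_const δ)) ?_
      exact measurable_pi_lambda _ fun k =>
        Int.measurable_floor.comp ((g k).measurable.div_const δ)
    have hA : ∀ l, MeasurableSet (ℓ ⁻¹' {l}) := fun l => hℓ (measurableSet_singleton l)
    let hi : ℤ × (Fin n → ℤ) := (⌊N / δ⌋, fun _ => ⌊N / δ⌋)
    let lo : ℤ × (Fin n → ℤ) := (⌊-N / δ⌋, fun _ => ⌊-N / δ⌋)
    -- Boundedness leaves finitely many cells. Null cells are discarded so that each remaining one
    -- contains points where the a.e. hypotheses hold.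
    let T := (Finset.Icc lo hi).filter fun l => ν (ℓ ⁻¹' {l}) ≠ 0
    let A : T → Set X := fun l => ℓ ⁻¹' {l.1}
    have hAm : ∀ l, MeasurableSet (A l) := fun l => hA _
    have hdisj : Pairwise (Function.onFun Disjoint A) := by
      intro l l' hll'
      refine Set.disjoint_left.2 fun x hx hx' => hll' (Subtype.ext ?_)
      exact (Set.mem_singleton_iff.1 hx).symm.trans (Set.mem_singleton_iff.1 hx')
    have hmem : ∀ᵐ x ∂ν, ℓ x ∈ T := by
      have hnull : ∀ᵐ x ∂ν, ∀ l, ν (ℓ ⁻¹' {l}) = 0 → ℓ x ≠ l := by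
        rw [ae_all_iff]
        intro l
        by_cases h0 : ν (ℓ ⁻¹' {l}) = 0
        · filter_upwards [measure_eq_zero_iff_ae_notMem.1 h0] with x hx _ using hx
        · exact Filter.Eventually.of_forall fun x h => absurd h h0
      filter_upwards [hnull, hf, hg] with x hx hfx hgx
      have hbd : ∀ t : ℝ, |t| ≤ N → ⌊-N / δ⌋ ≤ ⌊t / δ⌋ ∧ ⌊t / δ⌋ ≤ ⌊N / δ⌋ := fun t ht =>
        ⟨Int.floor_le_floor (div_le_div_of_nonneg_right (abs_le.1 ht).1 hδ.le),
          Int.floor_le_floor (div_le_div_of_nonneg_right (abs_le.1 ht).2 hδ.le)⟩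
      refine Finset.mem_filter.2 ⟨Finset.mem_Icc.2 ⟨?_, ?_⟩, fun h0 => hx _ h0 rfl⟩
      · exact ⟨(hbd _ hfx).1, fun k => (hbd _ (hgx k)).1⟩
      · exact ⟨(hbd _ hfx).2, fun k => (hbd _ (hgx k)).2⟩
    have hpos : ∀ l : T, ν (A l) ≠ 0 := fun l => (Finset.mem_filter.1 l.2).2
    let a : T → ℝ := fun l => δ * l.1.1
    let b : Fin n → T → ℝ := fun k l => δ * l.1.2 k
    have ha : ∀ (l : T) x, x ∈ A l → |f x - a l| ≤ δ := by
      intro l x hx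
      have : l.1 = ℓ x := (Set.mem_singleton_iff.1 hx).symm
      simp only [a, this]
      exact hround _
    have hb : ∀ k (l : T) x, x ∈ A l → |g k x - b k l| ≤ δ := by
      intro k l x hx
      have : l.1 = ℓ x := (Set.mem_singleton_iff.1 hx).symm
      simp only [b, this]
      exact hround _
    -- In the two-point inequality, `f` and each of the `n` functions `g k` is rounded at two
    -- points.
    let d : ℝ := (2 * n + 2) * δ
    have hd : 0 ≤ d := by positivity
    have hexists : ∀ (l : T) {p : X → Prop}, (∀ᵐ x ∂ν, p x) → ∃ x ∈ A l, p x := fun l p hp =>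
      ((frequently_ae_mem_iff.2 (hpos l)).and_eventually hp).exists
    have hab1 : ∀ l, |a l| ≤ ∑ k, |b k l| + d := by
      intro l
      obtain ⟨x, hx, hfx⟩ := hexists l h1
      have e1 := abs_sub_abs_le_abs_sub (a l) (f x)
      rw [abs_sub_comm] at e1
      have e2 : ∑ k, |g k x| ≤ ∑ k, (|b k l| + δ) := Finset.sum_le_sum fun k _ => by
        linarith [abs_sub_abs_le_abs_sub (g k x) (b k l), hb k l x hx]
      rw [Finset.sum_add_distrib, Finset.sum_const, Finset.card_univ, Fintype.card_fin,
        nsmul_eq_mul] at e2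
      have e3 : 0 ≤ n * δ := by positivity
      simp only [d]
      linarith [ha l x hx]
    have hab2 : ∀ l l', |a l - a l'| ≤ ∑ k, |b k l - b k l'| + d := by
      intro l l'
      obtain ⟨x, hx, hfx⟩ := hexists l h2
      -- The exceptional null set for `y` depends on `x`, so `x` is fixed first.
      obtain ⟨y, hy, hfy⟩ := hexists l' hfx
      have tri : ∀ p q r s : ℝ, |p - r| ≤ δ → |q - s| ≤ δ → |p - q| ≤ |r - s| + 2 * δ := by
        intro p q r s hpr hqs
        have e : p - q = (p - r) + (r - s) - (q - s) := by ring
        rw [e]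
        linarith [abs_sub ((p - r) + (r - s)) (q - s), abs_add_le (p - r) (r - s)]
      have e1 := tri (a l) (a l') (f x) (f y) (by rw [abs_sub_comm]; exact ha l x hx)
        (by rw [abs_sub_comm]; exact ha l' y hy)
      have e2 : ∑ k, |g k x - g k y| ≤ ∑ k, (|b k l - b k l'| + 2 * δ) :=
        Finset.sum_le_sum fun k _ => tri _ _ _ _ (hb k l x hx) (hb k l' y hy)
      rw [Finset.sum_add_distrib, Finset.sum_const, Finset.card_univ, Fintype.card_fin,
        nsmul_eq_mul] at e2
      simp only [d]
      linarith
    let S : (T → ℝ) → (X →ₘ[m] ℝ) := fun a => ∑ l, a l • indicatorClass m (hAm l)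
    have happrox : ∀ (u : X →ₘ[m] ℝ) (a : T → ℝ), (∀ l x, x ∈ A l → |u x - a l| ≤ δ) →
        ∀ᵐ x ∂ν, |u x - S a x| ≤ δ := by
      intro u a hu
      filter_upwards [hν.ae_le (coeFn_sum_smul_indicatorClass hAm hdisj a), hmem] with x hx hxT
      have hxA : x ∈ A ⟨ℓ x, hxT⟩ := rfl
      simp only [S]
      rw [hx.1 _ hxA]
      exact hu _ x hxA
    have hsimple := hQ.rpow_half_sum_indicator_le hle hAm hdisj hd hab1 hab2
    have hfS : Q f ^ (1 / 2 : ℝ) ≤ Q (S a) ^ (1 / 2 : ℝ) + ENNReal.ofReal δ * c := by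
      have e1 := Q.rpow_half_add_le (S a) (f - S a)
      rw [add_sub_cancel] at e1
      refine e1.trans (add_le_add_right (rpow_half_le_of_ae_le hle hδ.le ?_) _)
      filter_upwards [happrox f a ha, hν.ae_le (AEEqFun.coeFn_sub f (S a))] with x hx hx'
      rwa [hx', Pi.sub_apply]
    have hgS : ∀ k, Q (S (b k)) ^ (1 / 2 : ℝ) ≤
        Q (g k) ^ (1 / 2 : ℝ) + ENNReal.ofReal δ * c := by
      intro k
      have e1 := Q.rpow_half_add_le (g k) (S (b k) - g k)
      rw [add_sub_cancel] at e1
      refine e1.trans (add_le_add_right (rpow_half_le_of_ae_le hle hδ.le ?_) _)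
      filter_upwards [happrox (g k) (b k) (hb k),
        hν.ae_le (AEEqFun.coeFn_sub (S (b k)) (g k))] with x hx hx'
      rwa [hx', Pi.sub_apply, abs_sub_comm]
    calc Q f ^ (1 / 2 : ℝ) ≤ ∑ k, (Q (g k) ^ (1 / 2 : ℝ) + ENNReal.ofReal δ * c) +
            ENNReal.ofReal d * c + ENNReal.ofReal δ * c :=
          hfS.trans (add_le_add_left (hsimple.trans
            (add_le_add_left (Finset.sum_le_sum fun k _ => hgS k) _)) _)
      _ = ∑ k, Q (g k) ^ (1 / 2 : ℝ) + ENNReal.ofReal (δ * (3 * n + 3)) * c := by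
          have e : δ * (3 * n + 3) = n * δ + d + δ := by simp only [d]; ring
          rw [Finset.sum_add_distrib, Finset.sum_const, Finset.card_univ, Fintype.card_fin,
            nsmul_eq_mul, e, ENNReal.ofReal_add (by positivity) hδ.le,
            ENNReal.ofReal_add (by positivity) hd,
            ENNReal.ofReal_mul (p := (n : ℝ)) (by positivity),
            ENNReal.ofReal_natCast]
          ring
  have hlim : Filter.Tendsto (fun δ : ℝ => ∑ k, Q (g k) ^ (1 / 2 : ℝ) +
      ENNReal.ofReal (δ * (3 * n + 3)) * c) (nhdsWithin 0 (Set.Ioi 0))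
      (nhds (∑ k, Q (g k) ^ (1 / 2 : ℝ) + ENNReal.ofReal (0 * (3 * n + 3)) * c)) := by
    refine Filter.Tendsto.mono_left ?_ nhdsWithin_le_nhds
    refine Filter.Tendsto.const_add _ (ENNReal.Tendsto.mul_const ?_ (Or.inr hcfin))
    exact (ENNReal.continuous_ofReal.comp (continuous_mul_const _)).tendsto 0
  rw [zero_mul, ENNReal.ofReal_zero, zero_mul, add_zero] at hlim
  exact ge_of_tendsto hlim (Filter.eventually_of_mem self_mem_nhdsWithin key)

end

/-! ### Approximate minimizers on convex sets. -/

namespace PosQuadForm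

variable {V : Type*} [AddCommGroup V] [Module ℝ V] (q : PosQuadForm V)

theorem half_smul_add_le {u v : V} {c : ℝ≥0∞} (hu : q u ≤ c) (hv : q v ≤ c) :
    q ((1 / 2 : ℝ) • (u + v)) ≤ c := by
  have h : q (u + v) ≤ 4 * c := by
    calc q (u + v) ≤ 2 * q u + 2 * q v := by rw [q.parallelogram']; exact le_add_self
      _ ≤ 2 * c + 2 * c := by gcongr
      _ = 4 * c := by ring
  rw [q.homogeneous']
  calc _ ≤ ENNReal.ofReal (|1 / 2| ^ 2) * (4 * c) := by gcongr
    _ = c := by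
      rw [← mul_assoc, show (4 : ℝ≥0∞) = ENNReal.ofReal 4 by simp,
        ← ENNReal.ofReal_mul (by positivity)]
      norm_num

/-- Approximate minimizers of a quadratic form on a decreasing family of convex sets form a Cauchy
filter for the form seminorm. -/
theorem exists_filter_of_midpoint_convex {I : Type*} [Nonempty I] {K : I → Set q.domain}
    (hconv : ∀ i, ∀ u ∈ K i, ∀ v ∈ K i, (1 / 2 : ℝ) • (u + v) ∈ K i)
    (hdir : Directed (· ≥ ·) K) {M : ℝ}
    (hM : ∀ i, ∀ η : ℝ, 0 < η → ∃ u ∈ K i, (q (u : V)).toReal ≤ M + η) :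
    ∃ F : Filter q.domain, F.NeBot ∧ (∀ i, K i ∈ F) ∧
      (∀ η : ℝ, 0 < η → ∀ᶠ u : q.domain in F, (q (u : V)).toReal ≤ M + η) ∧
      ∀ η : ℝ, 0 < η → ∀ᶠ p in F ×ˢ F, (q ((p.1 - p.2 : q.domain) : V)).toReal ≤ η := by
  let Q : q.domain → ℝ := fun u => (q (u : V)).toReal
  have hQ : ∀ u, 0 ≤ Q u := fun _ => ENNReal.toReal_nonneg
  have hbdd : ∀ i, BddBelow (Set.range fun u : K i => Q u) := fun i =>
    ⟨0, by rintro _ ⟨u, rfl⟩; exact hQ u⟩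
  have hne : ∀ i, Nonempty (K i) := fun i =>
    let ⟨u, hu, _⟩ := hM i 1 one_pos
    ⟨⟨u, hu⟩⟩
  let s : I → ℝ := fun i => ⨅ u : K i, Q u
  have hs : ∀ i, ∀ u ∈ K i, s i ≤ Q u := fun i u hu => ciInf_le (hbdd i) ⟨u, hu⟩
  have hsM : ∀ i, s i ≤ M := fun i => le_of_forall_pos_le_add fun η hη =>
    let ⟨u, hu, hle⟩ := hM i η hη
    (hs i u hu).trans hle
  have hsbdd : BddAbove (Set.range s) := ⟨M, by rintro _ ⟨i, rfl⟩; exact hsM i⟩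
  -- The filter is generated by near-minimizers relative to the limiting infimum `t`, not relative
  -- to the cruder bound `M`.
  let t : ℝ := ⨆ i, s i
  have htM : t ≤ M := ciSup_le hsM
  let A : I × {η : ℝ // 0 < η} → Set q.domain := fun p => K p.1 ∩ {u | Q u ≤ t + p.2}
  have hA : Directed (· ≥ ·) A := by
    rintro ⟨i, η⟩ ⟨j, θ⟩
    obtain ⟨k, hki, hkj⟩ := hdir i j
    refine ⟨(k, ⟨min η.1 θ.1, lt_min η.2 θ.2⟩), fun u hu => ⟨hki hu.1, ?_⟩,
      fun u hu => ⟨hkj hu.1, ?_⟩⟩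
    · exact hu.2.out.trans (add_le_add_right (min_le_left _ _) _)
    · exact hu.2.out.trans (add_le_add_right (min_le_right _ _) _)
  have hAne : ∀ p, (A p).Nonempty := by
    rintro ⟨i, η⟩
    obtain ⟨⟨u, hu⟩, hlt⟩ := exists_lt_of_ciInf_lt (lt_add_of_pos_right (s i) η.2)
    exact ⟨u, hu, hlt.le.trans (add_le_add_left (le_ciSup hsbdd i) _)⟩
  have : Nonempty (I × {η : ℝ // 0 < η}) := ⟨(Classical.arbitrary I, ⟨1, one_pos⟩)⟩
  have hmem : ∀ p, A p ∈ ⨅ p, Filter.principal (A p) := fun p =>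
    Filter.mem_iInf_of_mem p (Filter.mem_principal_self _)
  refine ⟨⨅ p, Filter.principal (A p), ?_, fun i => ?_, fun η hη => ?_, fun η hη => ?_⟩
  · refine Filter.iInf_neBot_of_directed' (fun p p' => ?_) fun p =>
      Filter.principal_neBot_iff.2 (hAne p)
    obtain ⟨r, h1, h2⟩ := hA p p'
    exact ⟨r, Filter.principal_mono.2 h1, Filter.principal_mono.2 h2⟩
  · exact Filter.mem_of_superset (hmem (i, ⟨1, one_pos⟩)) fun u hu => hu.1
  · refine Filter.mem_of_superset (hmem (Classical.arbitrary I, ⟨η, hη⟩)) fun u hu => ?_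
    exact hu.2.out.trans (add_le_add_left htM _)
  -- As the midpoint stays in `K i`, `Q(u - v) = 2Q(u) + 2Q(v) - 4Q((u + v)/2) ≤ 4(t + η/8) - 4(t -
  -- η/8) = η`.
  · obtain ⟨i, hi⟩ := exists_lt_of_lt_ciSup (sub_lt_self t (show 0 < η / 8 by positivity))
    have h := hmem (i, ⟨η / 8, by positivity⟩)
    filter_upwards [Filter.prod_mem_prod h h]
    rintro ⟨u, v⟩ ⟨hu, hv⟩
    have hmid := hs i _ (hconv i u hu.1 v hv.1)
    have e : Q ((1 / 2 : ℝ) • (u + v)) = (1 / 2) ^ 2 * Q (u + v) := q.smul_toReal _ _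
    have hp := q.parallelogram_toReal u v
    have hu' : Q u ≤ t + η / 8 := hu.2
    have hv' : Q v ≤ t + η / 8 := hv.2
    change Q (u - v) ≤ η
    change 2 * Q u + 2 * Q v = Q (u - v) + Q (u + v) at hp
    linarith

end PosQuadForm

/-! ### Local convergence in measure and limits for closed forms. -/

section
variable {X : Type*} [MeasurableSpace X] {m : Measure X}

theorem localDist_self (U : Set X) (f : X →ₘ[m] ℝ) : localDist m U f f = 0 := by
  simp [localDist]

theorem localDist_comm (U : Set X) (f g : X →ₘ[m] ℝ) : localDist m U f g = localDist m U g f := by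
  simp only [localDist, abs_sub_comm]

theorem measurable_localDist_integrand (f g : X →ₘ[m] ℝ) :
    Measurable fun x => ENNReal.ofReal (min |f x - g x| 1) :=
  ((f.measurable.sub g.measurable).abs.min measurable_const).ennreal_ofReal

theorem localDist_triangle (U : Set X) (f g h : X →ₘ[m] ℝ) :
    localDist m U f h ≤ localDist m U f g + localDist m U g h := by
  rw [localDist, localDist, localDist, ← lintegral_add_left (measurable_localDist_integrand f g)]
  refine lintegral_mono fun x => ?_
  rw [← ENNReal.ofReal_add (by positivity) (by positivity)]
  refine ENNReal.ofReal_le_ofReal ?_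
  have h1 := abs_sub_le (f x) (g x) (h x)
  rcases le_total |f x - g x| 1 with h2 | h2
  · rcases le_total |g x - h x| 1 with h3 | h3
    · rw [min_eq_left h2, min_eq_left h3]
      exact (min_le_left _ _).trans h1
    · rw [min_eq_right h3]
      exact (min_le_right _ _).trans (le_add_of_nonneg_left (by positivity))
  · rw [min_eq_right h2]
    exact (min_le_right _ _).trans (le_add_of_nonneg_right (by positivity))

theorem localDist_sub_zero (U : Set X) (f g : X →ₘ[m] ℝ) :
    localDist m U (f - g) 0 = localDist m U f g := by
  refine lintegral_congr_ae (ae_restrict_of_ae ?_)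
  filter_upwards [AEEqFun.coeFn_sub f g, AEEqFun.coeFn_zero (μ := m) (β := ℝ)] with x h1 h2
  rw [h1, h2]
  simp

/-- Convergence in the form topology of a closed form, for filters that are Cauchy for the form
seminorm and for all the pseudometrics of local convergence in measure. -/
theorem PosQuadForm.IsClosedForm.exists_limit {E : PosQuadForm (X →ₘ[m] ℝ)}
    (hE : E.IsClosedForm (localMeasureTopology m)) {F : Filter E.domain} [F.NeBot]
    (hF : ∀ η : ℝ, 0 < η → ∀ᶠ p in F ×ˢ F, E.formSeminorm (p.1 - p.2) < η)
    (hF' : ∀ U : Set X, MeasurableSet U → m U < ∞ → Filter.Tendsto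
      (fun p : E.domain × E.domain => localDist m U (p.1 : X →ₘ[m] ℝ) p.2) (F ×ˢ F) (nhds 0)) :
    ∃ a : E.domain, (∀ η : ℝ, 0 < η → ∀ᶠ u in F, E.formSeminorm (u - a) < η) ∧
      ∀ U : Set X, MeasurableSet U → m U < ∞ →
        Filter.Tendsto (fun u : E.domain => localDist m U (u : X →ₘ[m] ℝ) a) F (nhds 0) := by
  have h0 : E.formSeminorm 0 = 0 := by
    simp [PosQuadForm.formSeminorm, E.map_zero]
  obtain ⟨a, ha⟩ := hE F ‹_› <| by
    suffices Filter.Tendsto (fun p : E.domain × E.domain => p.1 - p.2) (F ×ˢ F)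
        (@nhds _ (E.formTopology (localMeasureTopology m)) 0) by
      intro W hW
      obtain ⟨A, hA, hAW⟩ := Filter.mem_prod_same_iff.1 (this hW)
      exact ⟨A, hA, fun u hu v hv => hAW (Set.mk_mem_prod hu hv)⟩
    rw [nhds_inf, @nhds_induced _ _ (localMeasureTopology m)]
    refine Filter.tendsto_inf.2 ⟨Filter.tendsto_comap_iff.2 ?_, ?_⟩
    · refine TopologicalSpace.tendsto_nhds_generateFrom_iff.2 ?_
      rintro _ ⟨U, g, r, hU, hmU, hr, rfl⟩ hg
      have ht := (hF' U hU hmU).add_const (localDist m U 0 g)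
      rw [zero_add] at ht
      filter_upwards [ht.eventually_lt_const hg] with p hp
      refine (localDist_triangle U _ 0 g).trans_lt ?_
      simp only [Function.comp_apply, Submodule.coe_sub]
      rwa [localDist_sub_zero]
    · refine TopologicalSpace.tendsto_nhds_generateFrom_iff.2 ?_
      rintro _ ⟨w, r, hr, rfl⟩ hw
      have hw' : E.formSeminorm (0 - w) < r := hw
      filter_upwards [hF _ (sub_pos.2 hw')] with p hp
      change E.formSeminorm (p.1 - p.2 - w) < r
      have := E.formSeminorm_add_le (p.1 - p.2) (0 - w)
      rw [zero_sub, ← sub_eq_add_neg, ← zero_sub] at this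
      linarith
  refine ⟨a, fun η hη => ha ?_, fun U hU hmU => ?_⟩
  · have hopen : @IsOpen _ (E.formTopology (localMeasureTopology m))
        {u | E.formSeminorm (u - a) < η} :=
      inf_le_right (a := TopologicalSpace.induced (fun u : E.domain => (u : X →ₘ[m] ℝ))
        (localMeasureTopology m)) _ (TopologicalSpace.isOpen_generateFrom_of_mem ⟨a, η, hη, rfl⟩)
    refine @IsOpen.mem_nhds _ (E.formTopology (localMeasureTopology m)) _ _ hopen ?_
    change E.formSeminorm (a - a) < η
    rwa [sub_self, h0]
  · rw [ENNReal.tendsto_nhds_zero]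
    intro ε hε
    obtain ⟨r, hr0, hr⟩ : ∃ r : ℝ, 0 < r ∧ ENNReal.ofReal r ≤ ε := by
      obtain ⟨r, hr0, hr⟩ := ENNReal.lt_iff_exists_nnreal_btwn.1 hε
      exact ⟨r, by simpa using hr0, by simpa using hr.le⟩
    have hopen : @IsOpen _ (E.formTopology (localMeasureTopology m))
        {u | localDist m U (u : X →ₘ[m] ℝ) a < ENNReal.ofReal r} := by
      refine inf_le_left (b := E.seminormTopology) _ ?_
      exact ⟨_, TopologicalSpace.isOpen_generateFrom_of_mem
        ⟨U, (a : X →ₘ[m] ℝ), r, hU, hmU, hr0, rfl⟩, rfl⟩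
    have hmem := @IsOpen.mem_nhds _ (E.formTopology (localMeasureTopology m)) _ _ hopen (by
      change localDist m U (a : X →ₘ[m] ℝ) a < ENNReal.ofReal r
      rw [localDist_self]
      exact ENNReal.ofReal_pos.2 hr0)
    filter_upwards [ha hmem] with u hu
    exact (show localDist m U (u : X →ₘ[m] ℝ) a < ENNReal.ofReal r from hu).le.trans hr

/-- Every finite-measure part of `{f ≠ g}` is null; by semifiniteness, so is the whole set. -/
theorem IsSemifiniteMeasure.eq_of_localDist_eq_zero (hm : IsSemifiniteMeasure m)
    {f g : X →ₘ[m] ℝ}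
    (h : ∀ U : Set X, MeasurableSet U → m U < ∞ → localDist m U f g = 0) : f = g := by
  refine AEEqFun.ext ?_
  have hS : MeasurableSet {x | f x ≠ g x} :=
    (measurableSet_eq_fun f.measurable g.measurable).compl
  have hfin : ∀ V ⊆ {x | f x ≠ g x}, MeasurableSet V → m V < ∞ → m V = 0 := by
    intro V hVS hV hmV
    have h0 := h V hV hmV
    rw [localDist, lintegral_eq_zero_iff (measurable_localDist_integrand f g)] at h0
    have h1 := (ae_restrict_iff' hV).1 h0
    refine measure_mono_null (fun x hx => ?_) h1
    simp only [Set.mem_compl_iff, Set.mem_ofPred_eq, Pi.zero_apply, ENNReal.ofReal_eq_zero,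
      not_forall, not_le]
    exact ⟨hx, lt_min (abs_pos.2 (sub_ne_zero.2 (hVS hx))) one_pos⟩
  change m {x | f x ≠ g x} = 0
  by_cases htop : m {x | f x ≠ g x} = ∞
  · obtain ⟨V, hVS, hV, hpos, hmV⟩ := hm _ hS htop
    exact absurd (hfin V hVS hV hmV) hpos.ne'
  · exact hfin _ subset_rfl hS (lt_top_iff_ne_top.2 htop)

end

/-! ### Recovering a closed form from its lower approximations. -/

section
variable {X : Type*} [MeasurableSpace X] {m : Measure X}

theorem smul_restrict_absolutelyContinuous (m : Measure X) (U : Set X) (α : ℝ≥0∞) :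
    α • m.restrict U ≪ m :=
  Measure.smul_absolutelyContinuous.trans Measure.restrict_le_self.absolutelyContinuous

/-- The integrand is at most `1` off `U`, and `min |t| 1 ≤ θ + t² / θ` on `U`. -/
theorem localDist_le {U V : Set X} (hU : MeasurableSet U) (hUV : U ⊆ V) {θ : ℝ} (hθ : 0 < θ)
    (f g : X →ₘ[m] ℝ) :
    localDist m V f g ≤ m (V \ U) + ENNReal.ofReal θ * m V +
      ENNReal.ofReal θ⁻¹ * lintegralSqForm (smul_restrict_absolutelyContinuous m U 1) (f - g) := by
  have hle : ∀ t : ℝ, min |t| 1 ≤ θ + θ⁻¹ * t ^ 2 := by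
    intro t
    refine (min_le_left _ _).trans ?_
    have h1 : |t| * θ ≤ (θ + θ⁻¹ * t ^ 2) * θ := by
      have : (θ + θ⁻¹ * t ^ 2) * θ = θ ^ 2 + |t| ^ 2 := by rw [sq_abs]; field_simp
      rw [this]
      nlinarith [sq_nonneg (|t| - θ)]
    exact le_of_mul_le_mul_right h1 hθ
  have h1 : localDist m V f g = localDist m (V \ U) f g + localDist m U f g := by
    have e : V = (V \ U) ∪ U := (Set.sdiff_union_of_subset hUV).symm
    conv_lhs => rw [e]
    rw [localDist, lintegral_union hU Set.disjoint_sdiff_left]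
    rfl
  have h2 : localDist m (V \ U) f g ≤ m (V \ U) := by
    calc localDist m (V \ U) f g ≤ ∫⁻ _ in V \ U, 1 ∂m := by
          refine lintegral_mono fun x => ?_
          rw [ENNReal.ofReal_le_one]
          exact min_le_right _ _
      _ = m (V \ U) := by simp
  have h3 : localDist m U f g ≤ ENNReal.ofReal θ * m V + ENNReal.ofReal θ⁻¹ *
      lintegralSqForm (smul_restrict_absolutelyContinuous m U 1) (f - g) := by
    rw [lintegralSqForm_apply, one_smul,
      ← lintegral_const_mul _ ((f - g).measurable.pow_const 2).ennreal_ofReal]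
    calc localDist m U f g ≤ ∫⁻ x in U, (ENNReal.ofReal θ +
          ENNReal.ofReal θ⁻¹ * ENNReal.ofReal ((f - g : X →ₘ[m] ℝ) x ^ 2)) ∂m := by
          refine lintegral_mono_ae (ae_restrict_of_ae ?_)
          filter_upwards [AEEqFun.coeFn_sub f g] with x hx
          rw [hx, ← ENNReal.ofReal_mul (by positivity), ← ENNReal.ofReal_add hθ.le (by positivity)]
          exact ENNReal.ofReal_le_ofReal (hle _)
      _ ≤ _ := by
          rw [lintegral_add_left measurable_const, setLIntegral_const]
          gcongr
  rw [h1, add_assoc]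
  exact add_le_add h2 h3

/-- The measurable sets of finite measure on which a given function is bounded above. -/
def boundedSets (m : Measure X) (φ : X → ℝ) : Set (Set X) :=
  {U | MeasurableSet U ∧ m U < ∞ ∧ ∃ N : ℝ, ∀ x ∈ U, φ x ≤ N}

/-- Sets on which `φ` is bounded exhaust `V` up to small measure, so `L²`-convergence on them
suffices for local convergence in measure. -/
theorem exists_mem_boundedSets {φ : X → ℝ} (hφ : Measurable φ) {V : Set X}
    (hV : MeasurableSet V) (hmV : m V < ∞) {η : ℝ≥0∞} (hη : 0 < η) :
    ∃ U ∈ boundedSets m φ, U ⊆ V ∧ m (V \ U) ≤ η := by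
  let U : ℕ → Set X := fun N => V ∩ {x | φ x ≤ N}
  have hU : ∀ N, MeasurableSet (U N) := fun N => hV.inter (measurableSet_le hφ measurable_const)
  have hlim : Filter.Tendsto (fun N => m (V \ U N)) Filter.atTop (nhds (m (⋂ N, V \ U N))) := by
    refine tendsto_measure_iInter_atTop (fun N => (hV.diff (hU N)).nullMeasurableSet) ?_
      ⟨0, ((measure_mono Set.sdiff_subset).trans_lt hmV).ne⟩
    intro N N' h x hx
    exact ⟨hx.1, fun hx' => hx.2 ⟨hx'.1, hx'.2.out.trans (Nat.cast_le.2 h)⟩⟩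
  have hempty : ⋂ N, V \ U N = ∅ := by
    refine Set.eq_empty_of_forall_notMem fun x hx => ?_
    obtain ⟨N, hN⟩ := exists_nat_ge (φ x)
    have := Set.mem_iInter.1 hx N
    exact this.2 ⟨this.1, hN⟩
  rw [hempty, measure_empty] at hlim
  obtain ⟨N, hN⟩ := ((ENNReal.tendsto_nhds_zero.1 hlim) η hη).exists
  exact ⟨U N, ⟨hU N, (measure_mono Set.inter_subset_left).trans_lt hmV, N, fun x hx => hx.2⟩,
    Set.inter_subset_left, hN⟩

theorem union_mem_boundedSets {φ : X → ℝ} {U U' : Set X} (hU : U ∈ boundedSets m φ)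
    (hU' : U' ∈ boundedSets m φ) : U ∪ U' ∈ boundedSets m φ := by
  obtain ⟨h1, h2, N, h3⟩ := hU
  obtain ⟨h1', h2', N', h3'⟩ := hU'
  refine ⟨h1.union h1', measure_union_lt_top h2 h2', max N N', ?_⟩
  rintro x (hx | hx)
  · exact (h3 x hx).trans (le_max_left _ _)
  · exact (h3' x hx).trans (le_max_right _ _)

/-- A closed form is bounded by the supremum of its infimal convolutions with
`α ∫_U f² dm`. -/
theorem PosQuadForm.IsClosedForm.le_of_infConv_le {E : PosQuadForm (X →ₘ[m] ℝ)}
    (hE : E.IsClosedForm (localMeasureTopology m)) (hm : IsSemifiniteMeasure m) {φ : X → ℝ}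
    (hφ : Measurable φ) {f : X →ₘ[m] ℝ} {M : ℝ≥0∞}
    (h : ∀ U ∈ boundedSets m φ, ∀ α : ℝ≥0∞, α ≠ ∞ →
      E.infConv (lintegralSqForm (smul_restrict_absolutelyContinuous m U α)) f ≤ M) :
    E f ≤ M := by
  rcases eq_or_ne M ∞ with rfl | hM
  · exact le_top
  let N : Set X → PosQuadForm (X →ₘ[m] ℝ) := fun U =>
    lintegralSqForm (smul_restrict_absolutelyContinuous m U 1)
  have hN : ∀ U U' : Set X, U ⊆ U' → ∀ u, N U u ≤ N U' u := by
    intro U U' hUU' u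
    simp only [N, lintegralSqForm_apply, one_smul]
    exact lintegral_mono_set hUU'
  let K : boundedSets m φ × {ε : ℝ // 0 < ε} → Set E.domain := fun p =>
    {u | N p.1 ((u : X →ₘ[m] ℝ) - f) ≤ ENNReal.ofReal p.2}
  have : Nonempty (boundedSets m φ × {ε : ℝ // 0 < ε}) :=
    ⟨⟨⟨∅, MeasurableSet.empty, by simp, 0, by simp⟩, ⟨1, one_pos⟩⟩⟩
  have hconv : ∀ i, ∀ u ∈ K i, ∀ v ∈ K i, (1 / 2 : ℝ) • (u + v) ∈ K i := by
    intro i u hu v hv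
    have e : (((1 / 2 : ℝ) • (u + v) : E.domain) : X →ₘ[m] ℝ) - f =
        (1 / 2 : ℝ) • (((u : X →ₘ[m] ℝ) - f) + ((v : X →ₘ[m] ℝ) - f)) := by
      rw [Submodule.coe_smul, Submodule.coe_add]
      module
    change N i.1 _ ≤ _
    rw [e]
    exact (N i.1).half_smul_add_le hu hv
  have hdir : Directed (· ≥ ·) K := by
    rintro ⟨U, ε⟩ ⟨U', ε'⟩
    refine ⟨(⟨U ∪ U', union_mem_boundedSets U.2 U'.2⟩, ⟨min ε.1 ε'.1, lt_min ε.2 ε'.2⟩),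
      fun u hu => ?_, fun u hu => ?_⟩
    · exact (hN _ _ Set.subset_union_left _).trans
        (le_trans hu (ENNReal.ofReal_le_ofReal (min_le_left _ _)))
    · exact (hN _ _ Set.subset_union_right _).trans
        (le_trans hu (ENNReal.ofReal_le_ofReal (min_le_right _ _)))
  have hex : ∀ i, ∀ η : ℝ, 0 < η → ∃ u ∈ K i, (E (u : X →ₘ[m] ℝ)).toReal ≤ M.toReal + η := by
    rintro ⟨⟨U, hU⟩, ⟨ε, hε⟩⟩ η hη
    have hpos : 0 < M.toReal + η := add_pos_of_nonneg_of_pos ENNReal.toReal_nonneg hη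
    have hlt : M < ENNReal.ofReal (M.toReal + η) := by
      rw [ENNReal.lt_ofReal_iff_toReal_lt hM]
      linarith
    -- With `α = (M + η) / ε`, a competitor of total cost below `M + η` has `∫_U (f - u)² dm ≤ ε`.
    have h1 := (h U hU (ENNReal.ofReal ((M.toReal + η) / ε)) ENNReal.ofReal_ne_top).trans_lt hlt
    rw [PosQuadForm.infConv_apply, iInf_lt_iff] at h1
    obtain ⟨u, hu⟩ := h1
    have hEu : E u < ENNReal.ofReal (M.toReal + η) := le_self_add.trans_lt hu
    refine ⟨⟨u, hEu.trans ENNReal.ofReal_lt_top⟩, ?_,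
      ENNReal.toReal_le_of_le_ofReal hpos.le hEu.le⟩
    have h2 := le_add_self.trans hu.le
    have e : lintegralSqForm (smul_restrict_absolutelyContinuous m U
        (ENNReal.ofReal ((M.toReal + η) / ε))) (f - u) =
        ENNReal.ofReal ((M.toReal + η) / ε) * N U (u - f) := by
      rw [← PosQuadForm.map_neg _ (f - u), neg_sub]
      simp only [N, lintegralSqForm_apply, lintegral_smul_measure, one_smul, smul_eq_mul]
    have e' : ENNReal.ofReal (M.toReal + η) =
        ENNReal.ofReal ((M.toReal + η) / ε) * ENNReal.ofReal ε := by
      rw [← ENNReal.ofReal_mul (by positivity), div_mul_cancel₀ _ hε.ne']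
    rw [e, e', ENNReal.mul_le_mul_iff_right (ENNReal.ofReal_pos.2 (div_pos hpos hε)).ne'
      ENNReal.ofReal_ne_top] at h2
    exact h2
  obtain ⟨F, hFne, hFK, hFM, hFc⟩ := E.exists_filter_of_midpoint_convex hconv hdir hex
  have hdist : ∀ V : Set X, MeasurableSet V → m V < ∞ →
      Filter.Tendsto (fun u : E.domain => localDist m V (u : X →ₘ[m] ℝ) f) F (nhds 0) := by
    intro V hV hmV
    rw [ENNReal.tendsto_nhds_zero]
    intro η hη
    rcases eq_or_ne η ∞ with rfl | hη'
    · simp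
    have hη3 : 0 < η / 3 := ENNReal.div_pos hη.ne' (by simp)
    obtain ⟨U, hU, hUV, hmU⟩ := exists_mem_boundedSets hφ hV hmV hη3
    obtain ⟨θ, hθ, hθle⟩ : ∃ θ : ℝ, 0 < θ ∧ ENNReal.ofReal θ * m V ≤ η / 3 := by
      have ht : Filter.Tendsto (fun θ : ℝ => ENNReal.ofReal θ * m V) (nhdsWithin 0 (Set.Ioi 0))
          (nhds (ENNReal.ofReal 0 * m V)) :=
        (ENNReal.Tendsto.mul_const (ENNReal.continuous_ofReal.tendsto 0)
          (Or.inr hmV.ne)).mono_left nhdsWithin_le_nhds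
      rw [ENNReal.ofReal_zero, zero_mul] at ht
      obtain ⟨θ, hle, hθ⟩ := (((ENNReal.tendsto_nhds_zero.1 ht) _ hη3).and
        self_mem_nhdsWithin).exists
      exact ⟨θ, hθ, hle⟩
    have hε : 0 < θ * (η / 3).toReal :=
      mul_pos hθ (ENNReal.toReal_pos hη3.ne' (ENNReal.div_ne_top hη' (by simp)))
    filter_upwards [hFK (⟨U, hU⟩, ⟨θ * (η / 3).toReal, hε⟩)] with u hu
    refine (localDist_le hU.1 hUV hθ _ _).trans ?_
    calc _ ≤ η / 3 + η / 3 + ENNReal.ofReal θ⁻¹ * ENNReal.ofReal (θ * (η / 3).toReal) :=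
          add_le_add (add_le_add hmU hθle) (mul_le_mul_right hu _)
      _ = η / 3 + η / 3 + η / 3 := by
          rw [← ENNReal.ofReal_mul (by positivity), inv_mul_cancel_left₀ hθ.ne',
            ENNReal.ofReal_toReal (ENNReal.div_ne_top hη' (by simp))]
      _ = η := ENNReal.add_thirds η
  -- The filter is Cauchy for the form seminorm and converges to `f` locally in measure. Closedness
  -- supplies a limit in the domain, which must then be `f`.
  obtain ⟨a, ha, ha'⟩ := hE.exists_limit (F := F) (fun η hη => by
      filter_upwards [hFc ((η / 2) ^ 2) (by positivity)] with p hp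
      refine (Real.sqrt_le_sqrt hp).trans_lt ?_
      rw [Real.sqrt_sq (by positivity)]
      linarith) (fun V hV hmV => by
      have h1 := hdist V hV hmV
      have h2 := (h1.comp Filter.tendsto_fst).add (h1.comp Filter.tendsto_snd)
      rw [add_zero] at h2
      refine tendsto_of_tendsto_of_tendsto_of_le_of_le tendsto_const_nhds h2
        (fun _ => zero_le) fun p => ?_
      refine (localDist_triangle V _ f _).trans_eq ?_
      rw [localDist_comm V f]
      rfl)
  have haf : f = a := by
    refine hm.eq_of_localDist_eq_zero fun V hV hmV => ?_
    have h2 := (hdist V hV hmV).add (ha' V hV hmV)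
    rw [add_zero] at h2
    refine le_antisymm (ge_of_tendsto' h2 fun u => ?_) zero_le
    rw [localDist_comm V _ f]
    exact localDist_triangle V _ _ _
  have hsem : E.formSeminorm a ≤ √M.toReal := by
    have key : ∀ η : ℝ, 0 < η → E.formSeminorm a ≤ √(M.toReal + η) + η := by
      intro η hη
      obtain ⟨u, hu, hu'⟩ := ((hFM η hη).and (ha η hη)).exists
      have h1 := E.formSeminorm_add_le u (a - u)
      rw [add_sub_cancel] at h1
      have h2 : E.formSeminorm (a - u) = E.formSeminorm (u - a) := by
        rw [PosQuadForm.formSeminorm, ← neg_sub, Submodule.coe_neg, E.map_neg]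
        rfl
      have h3 : E.formSeminorm u ≤ √(M.toReal + η) := Real.sqrt_le_sqrt hu
      linarith
    have hlim : Filter.Tendsto (fun η : ℝ => √(M.toReal + η) + η) (nhdsWithin 0 (Set.Ioi 0))
        (nhds (√(M.toReal + 0) + 0)) := by
      refine Filter.Tendsto.mono_left ?_ nhdsWithin_le_nhds
      exact Continuous.tendsto (by fun_prop) 0
    rw [add_zero, add_zero] at hlim
    exact ge_of_tendsto hlim (Filter.eventually_of_mem self_mem_nhdsWithin key)
  rw [haf, ← ENNReal.toReal_le_toReal (E.ne_top a) hM]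
  exact (Real.sqrt_le_sqrt_iff ENNReal.toReal_nonneg).1 hsem

end

/-! ### Conclusion. -/

section
variable {X : Type*} [MeasurableSpace X] {m : Measure X}

theorem IsEnergyForm.rpow_half_le_sum {E : PosQuadForm (X →ₘ[m] ℝ)} (hE : IsEnergyForm E) {n : ℕ}
    {f : X →ₘ[m] ℝ} {g : Fin n → (X →ₘ[m] ℝ)} (h1 : ∀ᵐ x ∂m, |f x| ≤ ∑ k, |g k x|)
    (h2 : ∀ᵐ x ∂m, ∀ᵐ y ∂m, |f x - f y| ≤ ∑ k, |g k x - g k y|) :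
    E f ^ (1 / 2 : ℝ) ≤ ∑ k, E (g k) ^ (1 / 2 : ℝ) := by
  -- A bound for `φ` on `U` bounds `f` and all `g k` there, as the bounded case requires.
  let φ : X → ℝ := fun x => |f x| + ∑ k, |g k x|
  have hφ : Measurable φ :=
    f.measurable.abs.add (Finset.measurable_fun_sum _ fun k _ => (g k).measurable.abs)
  suffices E f ≤ (∑ k, E (g k) ^ (1 / 2 : ℝ)) ^ (2 : ℝ) by
    refine (ENNReal.rpow_le_rpow this (by norm_num : (0 : ℝ) ≤ 1 / 2)).trans_eq ?_
    rw [← ENNReal.rpow_mul]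
    norm_num
  refine hE.closed.le_of_infConv_le hE.localizable.1 hφ fun U hU α hα => ?_
  obtain ⟨hUm, hmU, N, hN⟩ := hU
  have hν := smul_restrict_absolutelyContinuous m U α
  have : IsFiniteMeasure (α • m.restrict U) := by
    refine ⟨?_⟩
    rw [Measure.smul_apply, Measure.restrict_apply_univ, smul_eq_mul]
    exact ENNReal.mul_lt_top hα.lt_top hmU
  have hmem : ∀ᵐ x ∂(α • m.restrict U), x ∈ U :=
    Measure.ae_smul_measure (ae_restrict_mem hUm) α
  have hf : ∀ᵐ x ∂(α • m.restrict U), |f x| ≤ N := by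
    filter_upwards [hmem] with x hx
    have h3 : 0 ≤ ∑ k, |g k x| := Finset.sum_nonneg fun _ _ => abs_nonneg _
    have := hN x hx
    simp only [φ] at this
    linarith
  have hg : ∀ᵐ x ∂(α • m.restrict U), ∀ k, |g k x| ≤ N := by
    filter_upwards [hmem] with x hx k
    have h3 : |g k x| ≤ ∑ k, |g k x| :=
      Finset.single_le_sum (f := fun k => |g k x|) (fun _ _ => abs_nonneg _) (Finset.mem_univ k)
    have := hN x hx
    simp only [φ] at this
    linarith [abs_nonneg (f x)]
  have key := (hE.markovian.infConv_lintegralSqForm hν).rpow_half_le_sum_of_bounded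
    (E.infConv_le_right _) hf hg (hν.ae_le h1)
    (by filter_upwards [hν.ae_le h2] with x hx using hν.ae_le hx)
  have key' := key.trans (Finset.sum_le_sum fun k _ => ENNReal.rpow_le_rpow
    (E.infConv_le_left _ (g k)) (by norm_num : (0 : ℝ) ≤ 1 / 2))
  calc _ = ((E.infConv (lintegralSqForm hν) f) ^ (1 / 2 : ℝ)) ^ (2 : ℝ) := by
        rw [← ENNReal.rpow_mul]
        norm_num
    _ ≤ _ := ENNReal.rpow_le_rpow key' (by norm_num)

/-- The normal contraction onto `[0, 1]`. -/
theorem isCutoff_clamp {ε : ℝ} (hε : 0 < ε) : IsCutoff ε fun x => max 0 (min x 1) where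
  normal := by
    refine ⟨by simp, fun x y => ?_⟩
    refine (abs_max_sub_max_le_max 0 (min x 1) 0 (min y 1)).trans ?_
    refine max_le (by simp) ((abs_min_sub_min_le_max x 1 y 1).trans ?_)
    simp
  mono := fun x y h => max_le_max le_rfl (min_le_min h le_rfl)
  range_mem := fun x => ⟨(neg_nonpos.2 hε.le).trans (le_max_left _ _),
    max_le (by linarith) ((min_le_right _ _).trans (by linarith))⟩
  eq_self := fun x hx => by rw [min_eq_left hx.2, max_eq_right hx.1]

end

theorem mainTheorem2 {X : Type*} [MeasurableSpace X] (m : Measure X)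
    (hm : IsLocalizableMeasure m) (E : PosQuadForm (X →ₘ[m] ℝ))
    (hE : E.IsClosedForm (localMeasureTopology m)) :
    List.TFAE [
      IsEnergyForm E,
      ∀ (C : ℝ → ℝ) (hC : IsNormalContraction₁ C) (f : X →ₘ[m] ℝ), E (hC.comp f) ≤ E f,
      ∀ (n : ℕ) (C : (Fin n → ℝ) → ℝ) (hC : IsNormalContraction C) (f : Fin n → (X →ₘ[m] ℝ)),
        (E (hC.comp f)) ^ (1 / 2 : ℝ) ≤ ∑ k, (E (f k)) ^ (1 / 2 : ℝ),
      ∀ (n : ℕ) (f : X →ₘ[m] ℝ) (g : Fin n → (X →ₘ[m] ℝ)),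
        (∀ᵐ x ∂m, |f x| ≤ ∑ k, |g k x|) →
        (∀ᵐ x ∂m, ∀ᵐ y ∂m, |f x - f y| ≤ ∑ k, |g k x - g k y|) →
        (E f) ^ (1 / 2 : ℝ) ≤ ∑ k, (E (g k)) ^ (1 / 2 : ℝ)] := by
  tfae_have 1 → 4 := fun h n f g h1 h2 => h.rpow_half_le_sum h1 h2
  tfae_have 4 → 3 := by
    intro h n C hC f
    have hmk : ∀ᵐ x ∂m, hC.comp f x = C fun k => f k x := AEEqFun.coeFn_mk _ _
    refine h n _ f ?_ ?_
    · filter_upwards [hmk] with x hx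
      rw [hx]
      simpa [hC.1] using hC.2 (fun k => f k x) 0
    · filter_upwards [hmk] with x hx
      filter_upwards [hmk] with y hy
      rw [hx, hy]
      exact hC.2 _ _
  tfae_have 3 → 2 := by
    intro h C hC f
    have hC' : IsNormalContraction fun x : Fin 1 → ℝ => C (x 0) :=
      ⟨hC.1, fun x y => by simpa using hC.2 (x 0) (y 0)⟩
    have e : hC'.comp (fun _ => f) = hC.comp f := by
      refine AEEqFun.ext ?_
      have hmk : ∀ᵐ x ∂m, hC'.comp (fun _ => f) x = C (f x) := AEEqFun.coeFn_mk _ _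
      filter_upwards [hmk, AEEqFun.coeFn_comp C hC.continuous f] with x h1 h2
      rw [h1, IsNormalContraction₁.comp, h2, Function.comp_apply]
    have h1 := h 1 _ hC' fun _ => f
    rw [e, Fin.sum_univ_one] at h1
    exact (ENNReal.rpow_le_rpow_iff (by norm_num)).1 h1
  tfae_have 2 → 1 := fun h =>
    ⟨hm, hE, fun _ hε => ⟨_, isCutoff_clamp hε, fun f => h _ (isCutoff_clamp hε).normal f⟩⟩
  tfae_finish
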